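/- Let $X$ be a finite nonempty set and let $T$ be a tournament on $X$: a binary relation such that for all $x,y\in X$ exactly one of $x=y$, $x\,T\,y$ ("$x$ beats $y$"), $y\,T\,x$ holds. Put $g(x,y)=1$ if $x\,T\,y$, $g(x,y)=-1$ if $y\,T\,x$, and $g(x,x)=0$, and for probability distributions $p,q$ on $X$ put $g(p,q)=\sum_{x,y}g(x,y)p(x)q(y)$. Let $p^*$ be the optimal strategy of $T$, i.e. the unique probability distribution on $X$ with $g(p^*,q)\ge 0$ for every probability distribution $q$ on $X$, and let $BP(T)=\{x: p^*(x)>0\}$ be its support. A Condorcet winner is an alternative $c\in X$ that beats every other alternative. An urn is a family $n=(n(x))_{x\in X}$ of strictly positive integers, and $\tilde n(x)=n(x)/\sum_{y}n(y)$. Two-alternatives reinforcement started at an urn $n_0$ is the random sequence of urns $(n_\tau)_{\tau\in\mathbb N}$ that starts at $n_0$ and in which, conditionally on $n_0,\dots,n_\tau$, two alternatives $a,b$ are picked independently according to $\tilde n_\tau$, and $n_{\tau+1}$ is obtained from $n_\tau$ by adding one ball of colour $\max\{a,b\}$, where $\max\{a,b\}=a$ if $a=b$ or $a\,T\,b$,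 and $\max\{a,b\}=b$ if $b\,T\,a$. Theorem. For every initial urn $n_0$, the sequence $(n_\tau)$ obtained by two-alternatives reinforcement satisfies: 1. almost surely, $\tilde n_\tau(x)\to 0$ as $\tau\to\infty$ for all $x\in X$ with $p^*(x)=0$; 2. if $T$ has no Condorcet winner, then with positive probability the sequence $(\tilde n_\tau)_{\tau\in\mathbb N}$ has no limit in $\mathbb R^X$; 3. if $T$ has no Condorcet winner and $BP(T)=X$ (that is, $p^*(x)>0$ for all $x\in X$), then almost surely the sequence $(\tilde n_\tau)_{\tau\in\mathbb N}$ has no limit in $\mathbb R^X$. -/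

import Mathlib

open Filter Topology MeasureTheory ProbabilityTheory

/-- A tournament on `X`: for all `x`, `y`, exactly one of `x = y`, `x` beats `y`, `y` beats `x`. -/
structure Tournament (X : Type*) where
  beats : X → X → Prop
  asymm : ∀ x y, beats x y → ¬ beats y x
  total : ∀ x y, x ≠ y → beats x y ∨ beats y x

namespace Tournament

variable {X : Type*}

/-- A Condorcet winner is an alternative that beats all other alternatives. -/
def HasCondorcetWinner (T : Tournament X) : Prop :=
  ∃ c, ∀ y, y ≠ c → T.beats c y

open Classical in
/-- The winner of the comparison of `a` and `b` (it is `a` if `a = b`). -/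
noncomputable def winner (T : Tournament X) (a b : X) : X :=
  if T.beats b a then b else a

open Classical in
/-- The payoff function of the tournament game: `1`, `-1` or `0` according to whether `x` beats `y`,
`y` beats `x`, or `x = y`. -/
noncomputable def payoff (T : Tournament X) (x y : X) : ℤ :=
  if T.beats x y then 1 else if T.beats y x then -1 else 0

theorem payoff_antisymm (T : Tournament X) (x y : X) : T.payoff x y = - T.payoff y x := by
  unfold payoff
  have := T.asymm x y
  split_ifs <;> simp_all

theorem payoff_self (T : Tournament X) (x : X) : T.payoff x x = 0 := by
  have := T.payoff_antisymm x x
  lia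

open Classical in
theorem payoff_cast_two (T : Tournament X) (x y : X) :
    ((T.payoff x y : ℤ) : ZMod 2) = if x = y then 0 else 1 := by
  by_cases h : x = y
  · subst h
    simp [payoff_self]
  · have := T.total x y h
    unfold payoff
    split_ifs <;> simp_all

section Fintype

variable [Fintype X]

/-- The expected payoff `g(p, q)`. -/
noncomputable def expectedPayoff (T : Tournament X) (p q : X → ℝ) : ℝ :=
  ∑ x, ∑ y, (T.payoff x y : ℝ) * p x * q y

/-- `p` is a probability distribution on `X` with `g(p, q) ≥ 0` for every distribution `q`. -/
def IsOptimalStrategy (T : Tournament X) (p : X → ℝ) : Prop :=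
  p ∈ stdSimplex ℝ X ∧ ∀ q ∈ stdSimplex ℝ X, 0 ≤ T.expectedPayoff p q

theorem expectedPayoff_eq (T : Tournament X) (p q : X → ℝ) :
    T.expectedPayoff p q = ∑ y, (∑ x, (T.payoff x y : ℝ) * p x) * q y := by
  unfold expectedPayoff
  rw [Finset.sum_comm]
  simp [Finset.sum_mul]

theorem expectedPayoff_antisymm (T : Tournament X) (p q : X → ℝ) :
    T.expectedPayoff p q = - T.expectedPayoff q p := by
  unfold expectedPayoff
  rw [Finset.sum_comm, ← Finset.sum_neg_distrib]
  refine Finset.sum_congr rfl fun x _ => ?_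
  rw [← Finset.sum_neg_distrib]
  refine Finset.sum_congr rfl fun y _ => ?_
  rw [T.payoff_antisymm y x]
  push_cast
  ring

open Classical in
theorem expectedPayoff_single (T : Tournament X) (p : X → ℝ) (y : X) :
    T.expectedPayoff p (Pi.single y 1) = ∑ x, (T.payoff x y : ℝ) * p x := by
  rw [expectedPayoff_eq]
  simp [Pi.single_apply]

theorem exists_isOptimalStrategy [Nonempty X] (T : Tournament X) :
    ∃ p, T.IsOptimalStrategy p := by
  classical
  let L : (X → ℝ) →ₗ[ℝ] (X → ℝ) :=
    { toFun := fun p y => ∑ x, (T.payoff x y : ℝ) * p x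
      map_add' := by
        intro p q
        ext y
        simp [mul_add, Finset.sum_add_distrib]
      map_smul' := by
        intro c p
        ext y
        simp [Finset.mul_sum, mul_left_comm] }
  have hLc : Continuous L := L.continuous_of_finiteDimensional
  by_contra hne
  have hdisj : Disjoint (L '' stdSimplex ℝ X) (Set.Ici 0) := by
    rw [Set.disjoint_left]
    rintro _ ⟨p, hp, rfl⟩ h0
    refine hne ⟨p, hp, fun q hq => ?_⟩
    rw [expectedPayoff_eq]
    exact Finset.sum_nonneg fun y _ => mul_nonneg (h0 y) (hq.1 y)
  obtain ⟨f, u, v, hfu, huv, hfv⟩ := geometric_hahn_banach_compact_closed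
    ((convex_stdSimplex ℝ X).linear_image L) ((isCompact_stdSimplex ℝ X).image hLc)
    (convex_Ici (0 : X → ℝ)) isClosed_Ici hdisj
  have hv0 : v < 0 := by simpa using hfv 0 (by simp)
  have hfe : ∀ z : X → ℝ, f z = ∑ y, z y * f (Pi.single y 1) := by
    intro z
    conv_lhs => rw [pi_eq_sum_univ' z]
    simp [map_sum]
  have hpos : ∀ y, 0 ≤ f (Pi.single y 1) := by
    intro y
    by_contra hy
    push Not at hy
    have h1 := hfv ((v / f (Pi.single y 1)) • Pi.single y 1) (by
      rw [Set.mem_Ici]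
      intro j
      have : 0 ≤ v / f (Pi.single y 1) := (div_pos_of_neg_of_neg hv0 hy).le
      by_cases hj : j = y
      · subst hj; simpa using this
      · simp [hj])
    rw [map_smul, smul_eq_mul, div_mul_cancel₀ _ hy.ne] at h1
    exact lt_irrefl _ h1
  set q : X → ℝ := fun y => f (Pi.single y 1) with hq
  have hneg : ∀ p ∈ stdSimplex ℝ X, T.expectedPayoff p q < 0 := by
    intro p hp
    have h1 := hfu (L p) ⟨p, hp, rfl⟩
    rw [hfe] at h1
    rw [expectedPayoff_eq]
    exact lt_trans h1 (huv.trans hv0)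
  have hs : 0 < ∑ y, q y := by
    refine lt_of_le_of_ne (Finset.sum_nonneg fun y _ => hpos y) fun h0 => ?_
    have hz : ∀ y, q y = 0 := fun y =>
      (Finset.sum_eq_zero_iff_of_nonneg fun y _ => hpos y).1 h0.symm y (Finset.mem_univ y)
    have h1 := hneg _ (single_mem_stdSimplex ℝ (Classical.arbitrary X))
    rw [expectedPayoff_eq] at h1
    simp [hz] at h1
  have h1 := hneg (fun y => q y / ∑ z, q z)
    ⟨fun y => div_nonneg (hpos y) hs.le, by rw [← Finset.sum_div, div_self hs.ne']⟩
  have h2 : T.expectedPayoff (fun y => q y / ∑ z, q z) q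
      = (∑ z, q z)⁻¹ * T.expectedPayoff q q := by
    unfold expectedPayoff
    simp only [Finset.mul_sum]
    refine Finset.sum_congr rfl fun x _ => Finset.sum_congr rfl fun y _ => ?_
    ring
  have h3 := T.expectedPayoff_antisymm q q
  have h4 : T.expectedPayoff q q = 0 := by linarith
  rw [h2, h4, mul_zero] at h1
  exact lt_irrefl _ h1

theorem eq_zero_of_even (T : Tournament X) (Z : Finset X) (hZ : Even Z.card) (v : X → ℝ)
    (hv : ∀ x ∉ Z, v x = 0) (hk : ∀ y ∈ Z, ∑ x, (T.payoff x y : ℝ) * v x = 0) (x : X) :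
    v x = 0 := by
  classical
  let A : Matrix Z Z ℤ := fun i j => T.payoff i j
  let J : Matrix Z Z (ZMod 2) := fun _ _ => 1
  have hA : A.map (Int.castRingHom (ZMod 2)) = J - 1 := by
    ext i j
    have h1 := T.payoff_cast_two i.1 j.1
    change ((T.payoff i.1 j.1 : ℤ) : ZMod 2) = 1 - (1 : Matrix Z Z (ZMod 2)) i j
    rw [h1, Matrix.one_apply]
    by_cases hij : i = j
    · simp [hij]
    · have h' : (i : X) ≠ j := fun h => hij (Subtype.ext h)
      simp [hij, h']
  have hJ : J * J = 0 := by
    ext i j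
    have h2 : ((Z.card : ℕ) : ZMod 2) = 0 := (ZMod.natCast_eq_zero_iff_even).2 hZ
    rw [Matrix.mul_apply]
    change ∑ _k : Z, (1 : ZMod 2) * 1 = 0
    simpa using h2
  have hsq : (J - 1) * (J - 1) = 1 := by
    have hJ2 : J + J = 0 := by
      ext i j
      exact CharTwo.add_self_eq_zero (1 : ZMod 2)
    calc (J - 1) * (J - 1) = J * J - (J + J) + 1 := by noncomm_ring
      _ = 1 := by rw [hJ, hJ2]; simp
  have hdet : A.det ≠ 0 := by
    intro h0
    have h1 : (A.map (Int.castRingHom (ZMod 2))).det = 0 := by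
      have := (RingHom.map_det (Int.castRingHom (ZMod 2)) A).symm
      rw [h0, map_zero] at this
      exact this
    have h2 := congrArg Matrix.det hsq
    rw [Matrix.det_mul, ← hA, h1] at h2
    simp at h2
  have hdetR : (A.map (Int.castRingHom ℝ)).det ≠ 0 := by
    have := (RingHom.map_det (Int.castRingHom ℝ) A).symm
    intro h0
    have h1 : (Int.castRingHom ℝ) A.det = 0 := this.symm.trans h0
    exact hdet (by simpa using h1)
  have h0 := Matrix.eq_zero_of_vecMul_eq_zero hdetR (v := fun i : Z => v i) (by
    ext j
    have h1 := hk j j.2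
    rw [← Finset.sum_subset (Finset.subset_univ Z) (by
      intro x _ hx
      rw [hv x hx, mul_zero]), ← Finset.sum_coe_sort] at h1
    change ∑ i : Z, v i * (T.payoff i j : ℝ) = 0
    simpa [mul_comm] using h1)
  by_cases hx : x ∈ Z
  · exact congrFun h0 ⟨x, hx⟩
  · exact hv x hx

theorem IsOptimalStrategy.sum_eq_zero {T : Tournament X} {p q : X → ℝ}
    (hp : T.IsOptimalStrategy p) (hq : T.IsOptimalStrategy q) {y : X} (hy : q y ≠ 0) :
    ∑ x, (T.payoff x y : ℝ) * p x = 0 := by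
  classical
  have h1 := hp.2 q hq.1
  have h2 := hq.2 p hp.1
  rw [expectedPayoff_antisymm] at h2
  have h3 : T.expectedPayoff p q = 0 := by linarith
  rw [expectedPayoff_eq, Finset.sum_eq_zero_iff_of_nonneg] at h3
  · exact (mul_eq_zero.1 (h3 y (Finset.mem_univ y))).resolve_right hy
  · intro z _
    refine mul_nonneg ?_ (hq.1.1 z)
    rw [← expectedPayoff_single]
    exact hp.2 _ (single_mem_stdSimplex ℝ z)

theorem IsOptimalStrategy.unique {T : Tournament X} {p q : X → ℝ}
    (hp : T.IsOptimalStrategy p) (hq : T.IsOptimalStrategy q) : p = q := by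
  classical
  obtain ⟨y₀, hy₀⟩ : ∃ y, p y ≠ 0 := by
    by_contra! h
    have := hp.1.2
    simp [h] at this
  let Y : Finset X := Finset.univ.filter fun y => p y ≠ 0 ∨ q y ≠ 0
  have hYmem : ∀ y, y ∈ Y ↔ (p y ≠ 0 ∨ q y ≠ 0) := by simp [Y]
  have hkp : ∀ y ∈ Y, ∑ x, (T.payoff x y : ℝ) * p x = 0 := fun y hy =>
    ((hYmem y).1 hy).elim (hp.sum_eq_zero hp) (hp.sum_eq_zero hq)
  have hkq : ∀ y ∈ Y, ∑ x, (T.payoff x y : ℝ) * q x = 0 := fun y hy =>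
    ((hYmem y).1 hy).elim (hq.sum_eq_zero hp) (hq.sum_eq_zero hq)
  have hy₀Y : y₀ ∈ Y := (hYmem y₀).2 (Or.inl hy₀)
  rcases Nat.even_or_odd Y.card with hY | hY
  · refine absurd (T.eq_zero_of_even Y hY p (fun x hx => ?_) hkp y₀) hy₀
    rw [hYmem] at hx
    tauto
  · have hZ : Even (Y.erase y₀).card := by
      rw [Finset.card_erase_of_mem hy₀Y]
      exact Nat.Odd.sub_odd hY odd_one
    have hv := T.eq_zero_of_even (Y.erase y₀) hZ (fun x => p y₀ * q x - q y₀ * p x)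
      (fun x hx => by
        by_cases hx0 : x = y₀
        · subst hx0; ring
        · have : x ∉ Y := fun h => hx (Finset.mem_erase.2 ⟨hx0, h⟩)
          rw [hYmem] at this
          push Not at this
          simp [this.1, this.2])
      (fun y hy => by
        have hyY := Finset.mem_of_mem_erase hy
        have : ∀ x, (T.payoff x y : ℝ) * (p y₀ * q x - q y₀ * p x)
            = p y₀ * ((T.payoff x y : ℝ) * q x) - q y₀ * ((T.payoff x y : ℝ) * p x) :=
          fun x => by ring
        simp only [this, Finset.sum_sub_distrib, ← Finset.mul_sum, hkp y hyY, hkq y hyY]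
        ring)
    have hs : ∑ x, (p y₀ * q x - q y₀ * p x) = 0 := Finset.sum_eq_zero fun x _ => hv x
    rw [Finset.sum_sub_distrib, ← Finset.mul_sum, ← Finset.mul_sum, hp.1.2, hq.1.2] at hs
    ext x
    have h1 := hv x
    have h2 : q y₀ = p y₀ := by linarith
    simp only [h2, ← mul_sub, mul_eq_zero, hy₀, false_or] at h1
    linarith

/-- The optimal strategy `p*` of the tournament game; it exists by `exists_isOptimalStrategy` and is
unique by `IsOptimalStrategy.unique`. -/
noncomputable def optimalStrategy [Nonempty X] (T : Tournament X) : X → ℝ :=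
  Classical.choose T.exists_isOptimalStrategy

theorem optimalStrategy_spec [Nonempty X] (T : Tournament X) :
    T.IsOptimalStrategy T.optimalStrategy :=
  Classical.choose_spec T.exists_isOptimalStrategy

/-- The Bipartisan Set `BP(T)`: the support of the optimal strategy. -/
def bipartisanSet [Nonempty X] (T : Tournament X) : Set X :=
  Function.support T.optimalStrategy

end Fintype

end Tournament

/-- An urn on `X`: a strictly positive number of balls of each colour `x : X`. -/
abbrev Urn (X : Type*) := X → ℕ+

namespace Urn

variable {X : Type*}

/-- The normalized composition of an urn. -/
noncomputable def normalized [Fintype X] (n : Urn X) : X → ℝ :=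
  fun x => (n x : ℝ) / ∑ y, (n y : ℝ)

open Classical in
/-- The urn `n` with one ball of colour `x` added. -/
noncomputable def addBall (n : Urn X) (x : X) : Urn X :=
  Function.update n x (n x + 1)

open Classical in
/-- The probability that `x` is the winner of the comparison of two alternatives `a`, `b` that are
picked independently in the urn `n`. -/
noncomputable def twoAlternativesProb [Fintype X] (T : Tournament X) (n : Urn X) (x : X) : ℝ :=
  ∑ a, ∑ b, if T.winner a b = x then n.normalized a * n.normalized b else 0

end Urn

/-- The random urn sequence `U` (on a probability space with measure `P`) is obtained from the
initial urn `n₀` by two-alternatives reinforcement: `U 0 = n₀` almost surely and, for every time `τ`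
and every history `h 0, …, h τ` of urns, the conditional probability given `U 0 = h 0, …, U τ = h τ`
that `U (τ + 1)` is the urn `h τ` with one ball of colour `x` added is the probability that `x` wins
the comparison of two alternatives picked independently in `h τ`. -/
structure IsTwoAlternativesReinforcement {X : Type*} [Fintype X] (T : Tournament X) (n₀ : Urn X)
    {Ω : Type*} [MeasurableSpace Ω] (P : Measure Ω) (U : ℕ → Ω → Urn X) : Prop where
  measurableSet : ∀ τ n, MeasurableSet {ω | U τ ω = n}
  initial : ∀ᵐ ω ∂P, U 0 ω = n₀
  step : ∀ (τ : ℕ) (h : ℕ → Urn X) (x : X),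
    P {ω | (∀ i ≤ τ, U i ω = h i) ∧ U (τ + 1) ω = (h τ).addBall x} =
      P {ω | ∀ i ≤ τ, U i ω = h i} * ENNReal.ofReal ((h τ).twoAlternativesProb T x)

theorem Urn.sum_twoAlternativesProb {X : Type*} [Fintype X] [Nonempty X] (T : Tournament X)
    (n : Urn X) : ∑ x, n.twoAlternativesProb T x = 1 := by
  classical
  have h1 : ∑ a, n.normalized a = 1 := by
    unfold Urn.normalized
    rw [← Finset.sum_div]
    exact div_self (Finset.sum_pos (fun y _ => by exact_mod_cast (n y).pos)
      Finset.univ_nonempty).ne'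
  unfold Urn.twoAlternativesProb
  rw [Finset.sum_comm]
  have : ∀ a, ∑ x, ∑ b, (if T.winner a b = x then n.normalized a * n.normalized b else 0)
      = n.normalized a := by
    intro a
    rw [Finset.sum_comm]
    simp [← Finset.mul_sum, h1]
  simp [this, h1]

theorem Urn.twoAlternativesProb_nonneg {X : Type*} [Fintype X] (T : Tournament X)
    (n : Urn X) (x : X) : 0 ≤ n.twoAlternativesProb T x := by
  have h : ∀ a, 0 ≤ n.normalized a := fun a =>
    div_nonneg (Nat.cast_nonneg _) (Finset.sum_nonneg fun _ _ => Nat.cast_nonneg _)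
  refine Finset.sum_nonneg fun a _ => Finset.sum_nonneg fun b _ => ?_
  split_ifs
  · exact mul_nonneg (h a) (h b)
  · exact le_rfl

theorem Urn.addBall_injective {X : Type*} (n : Urn X) : Function.Injective n.addBall := by
  classical
  intro x y hxy
  by_contra hne
  have h1 := congrFun hxy x
  simp only [Urn.addBall, Function.update_self, Function.update_of_ne hne] at h1
  have h2 := congrArg PNat.val h1
  simp at h2

/-- Two-alternatives reinforcement processes exist for every tournament and every initial urn. -/
theorem exists_isTwoAlternativesReinforcement {X : Type*} [Fintype X] [Nonempty X]
    (T : Tournament X) (n₀ : Urn X) :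
    ∃ (_m : MeasurableSpace (ℕ → Urn X)) (P : Measure (ℕ → Urn X)), IsProbabilityMeasure P ∧
      IsTwoAlternativesReinforcement T n₀ P (fun τ ω => ω τ) := by
  classical
  let mU : MeasurableSpace (Urn X) := ⊤
  have hdU : DiscreteMeasurableSpace (Urn X) := ⟨fun _ => trivial⟩
  let stepMeasure : Urn X → Measure (Urn X) := fun n =>
    ∑ x, ENNReal.ofReal (n.twoAlternativesProb T x) • Measure.dirac (n.addBall x)
  have hprob : ∀ n, IsProbabilityMeasure (stepMeasure n) := by
    intro n
    refine ⟨?_⟩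
    simp only [stepMeasure, Measure.finsetSum_apply, Measure.smul_apply, measure_univ,
      smul_eq_mul, mul_one]
    rw [← ENNReal.ofReal_sum_of_nonneg fun x _ => n.twoAlternativesProb_nonneg T x,
      n.sum_twoAlternativesProb T, ENNReal.ofReal_one]
  let κ : (τ : ℕ) → Kernel ((i : Finset.Iic τ) → Urn X) (Urn X) := fun τ =>
    { toFun := fun h => stepMeasure (h ⟨τ, Finset.mem_Iic.2 le_rfl⟩)
      measurable' := (Measurable.of_discrete (f := stepMeasure)).comp (measurable_pi_apply _) }
  have hκ : ∀ τ, IsMarkovKernel (κ τ) := fun τ => ⟨fun h => hprob _⟩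
  let P : Measure (ℕ → Urn X) :=
    Kernel.traj (X := fun _ => Urn X) κ 0 (fun _ => n₀)
  have hP : IsProbabilityMeasure P := by
    change IsProbabilityMeasure (Kernel.traj (X := fun _ => Urn X) κ 0 (fun _ => n₀))
    infer_instance
  refine ⟨MeasurableSpace.pi, P, hP, ?_, ?_, ?_⟩
  · intro τ n
    exact (measurable_pi_apply (X := fun _ : ℕ => Urn X) τ) (MeasurableSet.singleton n)
  · have h0 := Kernel.traj_map_frestrictLe_apply (X := fun _ => Urn X) (κ := κ) 0 0
      (fun _ => n₀)
    rw [Kernel.partialTraj_self, Kernel.id_apply] at h0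
    have h1 : ∀ᵐ z ∂(P.map (Preorder.frestrictLe 0)), z = fun _ => n₀ := by
      rw [h0]
      exact (ae_dirac_iff (MeasurableSet.singleton _)).2 rfl
    have h2 := ae_of_ae_map (by fun_prop) h1
    filter_upwards [h2] with ω hω
    exact congrFun hω ⟨0, by simp⟩
  · intro τ h x
    have key := Kernel.partialTraj_compProd_eq_map_traj
      (X := fun _ => Urn X) (κ := κ) (Nat.zero_le τ) (x₀ := fun _ => n₀)
    rw [← Kernel.traj_map_frestrictLe_apply] at key
    let h' : (i : Finset.Iic τ) → Urn X := fun i => h i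
    have hm : MeasurableSet ({h'} : Set ((i : Finset.Iic τ) → Urn X)) := MeasurableSet.singleton h'
    have h1 := congrArg (fun μ => μ ({h'} ×ˢ {(h τ).addBall x})) key
    beta_reduce at h1
    rw [Measure.compProd_apply_prod hm (MeasurableSet.singleton _), Measure.map_apply (by fun_prop)
      (hm.prod (MeasurableSet.singleton _))] at h1
    simp only [lintegral_singleton] at h1
    rw [Measure.map_apply (by fun_prop) hm] at h1
    have h2 : κ τ h' {(h τ).addBall x} = ENNReal.ofReal ((h τ).twoAlternativesProb T x) := by
      change stepMeasure (h τ) {(h τ).addBall x} = _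
      simp only [stepMeasure, Measure.finsetSum_apply, Measure.smul_apply, smul_eq_mul]
      simp [Set.indicator_apply, (h τ).addBall_injective.eq_iff]
    rw [h2, mul_comm] at h1
    have e1 : (Preorder.frestrictLe τ : (ℕ → Urn X) → _) ⁻¹' {h'} = {ω | ∀ i ≤ τ, ω i = h i} := by
      ext ω
      simp [funext_iff, h']
    have e2 : (fun ω : ℕ → Urn X => ((Preorder.frestrictLe τ ω : (i : Finset.Iic τ) → Urn X), ω (τ + 1))) ⁻¹'
        ({h'} ×ˢ {(h τ).addBall x}) =
        {ω | (∀ i ≤ τ, ω i = h i) ∧ ω (τ + 1) = (h τ).addBall x} := by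
      ext ω
      simp [funext_iff, h']
    rw [← e1, ← e2]
    exact h1.symm

/-! Write `N` for the number of balls and `x` for the composition of the urn. One step moves `x(a)`
in expectation by `x(a) g(a, x) / (N + 1)`, so the process is a noisy discretization of the
replicator dynamics of the tournament game. Under these dynamics the entropy of `p*` relative to `x`
decreases at rate `g(p*, x) ≥ 0`. The proof uses `gap`, in which the logarithms of ball counts are
replaced by harmonic sums. A ball of colour `a` then changes it by exactly `1 / N - p*(a) / n(a)`,
and its expected change is exactly `-g(p*, x) / N` (`Urn.step_gap`). It exceeds the relative entropy
by a nonnegative correction.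

Claim 1: since `gap` is a nonnegative supermartingale, the expected values of `g(p*, x) / N` have a
finite sum. A parity argument makes alternatives outside the support do strictly worse than `p*`
against `p*`, so `g(p*, x)` dominates a multiple of their total share. Hence `x(a) / N` is summable
for such `a`, and slow variation forces `x(a) → 0`.

For claims 2 and 3, the martingale part of `x` converges and the harmonic series diverges, so almost
surely a limit of the compositions can only be a rest point of the replicator dynamics. If it
charges the whole support, and no missing alternative is profitable against it, it is `p*`, and then
`gap → 0`.

Claim 3: with full support `gap` is a martingale. Near `p*` the variance of its increment is of
order at most `gap / N ^ 2`, while `gap` is at least of order `1 / N`; thus its future fluctuations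
are at most comparable with its present value. A second moment bound shows that from every urn the
probability of staying near `p*` with `gap → 0` is at most a constant `ρ < 1`. By Lévy's zero-one
law this probability is zero.

Claim 2: with positive probability an urn is reached that has many balls, few of them outside the
support, and `gap` close to a small `δ > 0`. A corrected version of `(gap - δ) ^ 2` is superharmonic
there, so a maximal inequality keeps `gap` in `[δ / 2, 3 δ / 2]` forever with positive probability.
On that event convergence would give `gap → 0`, a contradiction. -/

/-! ### Harmonic sums and harmonically weighted series -/

/-- The partial sums `∑_{0 < k < n} 1 / k` of the harmonic series. -/
noncomputable def harmonicBelow (n : ℕ) : ℝ :=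
  ∑ k ∈ Finset.range n, (k : ℝ)⁻¹

theorem harmonicBelow_succ (n : ℕ) : harmonicBelow (n + 1) = harmonicBelow n + (n : ℝ)⁻¹ :=
  Finset.sum_range_succ _ _

/-- The difference between a partial sum of the harmonic series and the logarithm. -/
noncomputable def harmonicDefect (n : ℕ) : ℝ :=
  harmonicBelow n - Real.log n

theorem tendsto_harmonicDefect :
    Tendsto harmonicDefect atTop (𝓝 Real.eulerMascheroniConstant) := by
  rw [← tendsto_add_atTop_iff_nat 1]
  refine Real.tendsto_eulerMascheroniSeq.congr fun n => ?_
  rw [Real.eulerMascheroniSeq, harmonicDefect, harmonicBelow, Finset.sum_range_succ', harmonic]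
  push_cast
  simp

/-- A single use of `log t ≤ t - 1` gives only monotonicity. Splitting `(n + 1) / n` at `(2 n + 1) /
(2 n)` and applying the inequality to both factors leaves a surplus `1 / (2 n (2 n + 1))`, of which
a telescoping fraction is kept. -/
theorem harmonicDefect_succ_sub {n : ℕ} (hn : 0 < n) :
    (1 / 6) * ((n : ℝ)⁻¹ - ((n + 1 : ℕ) : ℝ)⁻¹) ≤ harmonicDefect (n + 1) - harmonicDefect n := by
  have h0 : (1 : ℝ) ≤ n := by exact_mod_cast hn
  have h1 : Real.log ((n + 1 : ℕ) : ℝ) - Real.log n ≤ 1 / (2 * n) + 1 / (2 * n + 1) := by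
    have e : Real.log ((n + 1 : ℕ) : ℝ) - Real.log n
        = Real.log ((2 * n + 1) / (2 * n)) + Real.log ((2 * n + 2) / (2 * n + 1)) := by
      rw [← Real.log_mul (by positivity) (by positivity), ← Real.log_div (by positivity)
        (by positivity)]
      congr 1
      push_cast
      field_simp
    have a := Real.log_le_sub_one_of_pos (x := (2 * (n : ℝ) + 1) / (2 * n)) (by positivity)
    have b := Real.log_le_sub_one_of_pos (x := (2 * (n : ℝ) + 2) / (2 * n + 1)) (by positivity)
    have a' : (2 * (n : ℝ) + 1) / (2 * n) - 1 = 1 / (2 * n) := by field_simp; ring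
    have b' : (2 * (n : ℝ) + 2) / (2 * n + 1) - 1 = 1 / (2 * n + 1) := by field_simp; ring
    linarith
  have h2 : (1 / 6) * ((n : ℝ)⁻¹ - ((n + 1 : ℕ) : ℝ)⁻¹)
      ≤ (n : ℝ)⁻¹ - (1 / (2 * n) + 1 / (2 * n + 1)) := by
    have e1 : (1 / 6) * ((n : ℝ)⁻¹ - ((n + 1 : ℕ) : ℝ)⁻¹) = 1 / (6 * (n * (n + 1))) := by
      push_cast
      field_simp
      ring
    have e2 : (n : ℝ)⁻¹ - (1 / (2 * n) + 1 / (2 * n + 1)) = 1 / (2 * n * (2 * n + 1)) := by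
      field_simp
      ring
    rw [e1, e2]
    apply one_div_le_one_div_of_le (by positivity)
    nlinarith
  simp only [harmonicDefect, harmonicBelow_succ]
  linarith

theorem harmonicDefect_sub_ge {m n : ℕ} (hm : 0 < m) (hmn : m ≤ n) :
    (1 / 6) * ((m : ℝ)⁻¹ - (n : ℝ)⁻¹) ≤ harmonicDefect n - harmonicDefect m := by
  induction n, hmn using Nat.le_induction with
  | base => simp
  | succ n hn ih =>
    have := harmonicDefect_succ_sub (hm.trans_le hn)
    linarith

/-- If a sequence converges to `L` and its harmonically weighted partial sums converge, then
`L = 0`. -/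
theorem eq_zero_of_tendsto_sum_div {φ : ℕ → ℝ} {L S c : ℝ} (hc : 0 < c)
    (hφ : Tendsto φ atTop (𝓝 L))
    (hS : Tendsto (fun n => ∑ r ∈ Finset.range n, φ r / (r + c)) atTop (𝓝 S)) : L = 0 := by
  have key : ∀ {φ : ℕ → ℝ} {L S : ℝ}, Tendsto φ atTop (𝓝 L) →
      Tendsto (fun n => ∑ r ∈ Finset.range n, φ r / (r + c)) atTop (𝓝 S) → L ≤ 0 := by
    intro φ L S hφ hS
    by_contra! hL
    obtain ⟨m, hm⟩ := eventually_atTop.1 (hφ.eventually_const_le (half_lt_self hL))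
    obtain ⟨B, hB⟩ := hS.bddAbove_range
    -- If `L > 0`, the terms eventually exceed `(L / 2) / (r + c)`, so bounded partial sums would
    -- make the harmonic series summable.
    have hB' : ∀ n, ∑ r ∈ Finset.range n, φ r / (r + c) ≤ B := fun n => hB ⟨n, rfl⟩
    have hsum : Summable fun r : ℕ => L / 2 / (((r + m : ℕ) : ℝ) + c) := by
      refine summable_of_sum_range_le (c := B - ∑ r ∈ Finset.range m, φ r / (r + c))
        (fun r => by positivity) fun n => ?_
      have h1 := hB' (m + n)
      rw [Finset.sum_range_add] at h1
      have h2 : ∑ r ∈ Finset.range n, L / 2 / (((r + m : ℕ) : ℝ) + c)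
          ≤ ∑ r ∈ Finset.range n, φ (m + r) / (((m + r : ℕ) : ℝ) + c) := by
        refine Finset.sum_le_sum fun r _ => ?_
        rw [add_comm r m]
        exact div_le_div_of_nonneg_right (hm _ (Nat.le_add_right _ _)) (by positivity)
      linarith
    rw [summable_nat_add_iff (f := fun r : ℕ => L / 2 / ((r : ℝ) + c)) m] at hsum
    have h3 : Summable fun r : ℕ => 1 / (r : ℝ) := by
      rw [← summable_nat_add_iff 1]
      refine (hsum.mul_left (2 / L * (1 + c))).of_nonneg_of_le (fun r => by positivity) fun r => ?_
      have e : 2 / L * (1 + c) * (L / 2 / ((r : ℝ) + c)) = (1 + c) / (r + c) := by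
        field_simp
      rw [e, div_le_div_iff₀ (by positivity) (by positivity)]
      push_cast
      nlinarith [(Nat.cast_nonneg r : (0 : ℝ) ≤ r)]
    exact Real.not_summable_one_div_natCast h3
  refine le_antisymm (key hφ hS) ?_
  have := key hφ.neg (S := -S) (by
    refine hS.neg.congr fun n => ?_
    rw [← Finset.sum_neg_distrib]
    exact Finset.sum_congr rfl fun r _ => (neg_div _ _).symm)
  linarith

/-- A sequence in `[0, 1]` that moves at most by `1 / (r + c)` at step `r` and is summable
with the weights `1 / (r + c)` tends to zero. -/
theorem tendsto_zero_of_summable_div {f : ℕ → ℝ} {c : ℝ} (hc : 0 < c) (h0 : ∀ r, 0 ≤ f r)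
    (hstep : ∀ r, |f (r + 1) - f r| ≤ 1 / (r + c))
    (hsum : Summable fun r : ℕ => f r / (r + c)) : Tendsto f atTop (𝓝 0) := by
  have hinv : Summable fun r : ℕ => (1 / ((r : ℝ) + c)) ^ 2 := by
    have h1 : Summable fun r : ℕ => 1 / (r : ℝ) ^ 2 := Real.summable_one_div_nat_pow.2 one_lt_two
    rw [← summable_nat_add_iff 1]
    refine h1.of_norm_bounded_eventually_nat ?_
    filter_upwards [eventually_gt_atTop 0] with r hr
    have hr' : (0 : ℝ) < r := by exact_mod_cast hr
    rw [Real.norm_of_nonneg (by positivity), div_pow, one_pow]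
    apply one_div_le_one_div_of_le (by positivity)
    push_cast
    nlinarith
  -- The increments of `f ^ 2` are at most `2 f r / (r + c) + 1 / (r + c) ^ 2`, hence summable. So
  -- `f ^ 2`, and with it `f`, converges, and the limit can only be zero.
  have hsq : Summable fun r : ℕ => f (r + 1) ^ 2 - f r ^ 2 := by
    refine Summable.of_norm_bounded ((hsum.mul_left 2).add hinv) fun r => ?_
    have hw : 0 < 1 / ((r : ℝ) + c) := by positivity
    have e : f (r + 1) ^ 2 - f r ^ 2 = (f (r + 1) - f r) * (f (r + 1) + f r) := by ring
    have h1 := h0 r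
    have h2 := h0 (r + 1)
    have h3 := (le_abs_self _).trans (hstep r)
    rw [Real.norm_eq_abs, e, abs_mul, abs_of_nonneg (add_nonneg h2 h1)]
    calc |f (r + 1) - f r| * (f (r + 1) + f r)
        ≤ 1 / (r + c) * (2 * f r + 1 / (r + c)) := by
          apply mul_le_mul (hstep r) (by linarith) (by linarith) hw.le
      _ = 2 * (f r / (r + c)) + (1 / ((r : ℝ) + c)) ^ 2 := by ring
  have hlim := hsq.hasSum.tendsto_sum_nat
  simp only [Finset.sum_range_sub (fun r => f r ^ 2)] at hlim
  have hlim2 : Tendsto (fun r => f r ^ 2) atTop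
      (𝓝 ((∑' r, (f (r + 1) ^ 2 - f r ^ 2)) + f 0 ^ 2)) :=
    (hlim.add_const (f 0 ^ 2)).congr fun r => by ring
  have hf : Tendsto f atTop (𝓝 (√((∑' r, (f (r + 1) ^ 2 - f r ^ 2)) + f 0 ^ 2))) :=
    ((Real.continuous_sqrt.tendsto _).comp hlim2).congr fun r => Real.sqrt_sq (h0 r)
  have := eq_zero_of_tendsto_sum_div hc hf hsum.hasSum.tendsto_sum_nat
  rwa [this] at hf

/-! ### Optimal strategies and strict complementarity -/

namespace Tournament

theorem abs_payoff_le_one {X : Type*} (T : Tournament X) (a b : X) : |(T.payoff a b : ℝ)| ≤ 1 := by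
  unfold payoff
  split_ifs <;> simp

variable {X : Type*} [Fintype X]

/-- The expected payoff `g(a, q)` of the alternative `a` against the mixed strategy `q`. -/
noncomputable def payoffAgainst (T : Tournament X) (a : X) (q : X → ℝ) : ℝ :=
  ∑ b, (T.payoff a b : ℝ) * q b

theorem expectedPayoff_eq_sum_payoffAgainst (T : Tournament X) (p q : X → ℝ) :
    T.expectedPayoff p q = ∑ a, p a * T.payoffAgainst a q := by
  unfold expectedPayoff payoffAgainst
  refine Finset.sum_congr rfl fun a _ => ?_
  rw [Finset.mul_sum]
  exact Finset.sum_congr rfl fun b _ => by ring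

theorem expectedPayoff_eq_neg_sum (T : Tournament X) (p q : X → ℝ) :
    T.expectedPayoff p q = - ∑ b, T.payoffAgainst b p * q b := by
  rw [T.expectedPayoff_antisymm, expectedPayoff_eq_sum_payoffAgainst]
  simp [mul_comm]

theorem continuous_payoffAgainst (T : Tournament X) (a : X) : Continuous (T.payoffAgainst a) := by
  unfold payoffAgainst
  fun_prop

theorem abs_payoffAgainst_le_one (T : Tournament X) (a : X) {q : X → ℝ}
    (hq : q ∈ stdSimplex ℝ X) : |T.payoffAgainst a q| ≤ 1 := by
  unfold payoffAgainst
  refine (Finset.abs_sum_le_sum_abs _ _).trans ?_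
  rw [← hq.2]
  refine Finset.sum_le_sum fun b _ => ?_
  rw [abs_mul, abs_of_nonneg (hq.1 b)]
  exact mul_le_of_le_one_left (hq.1 b) (T.abs_payoff_le_one a b)

theorem payoffAgainst_le_add (T : Tournament X) (a : X) {p q : X → ℝ} {ε : ℝ}
    (h : ∀ b, |q b - p b| ≤ ε) :
    T.payoffAgainst a q ≤ T.payoffAgainst a p + Fintype.card X * ε := by
  have h1 : T.payoffAgainst a q - T.payoffAgainst a p ≤ ∑ _b : X, ε := by
    unfold payoffAgainst
    rw [← Finset.sum_sub_distrib]
    refine Finset.sum_le_sum fun b _ => ?_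
    rw [← mul_sub]
    refine (le_abs_self _).trans ?_
    rw [abs_mul]
    exact (mul_le_of_le_one_left (abs_nonneg _) (T.abs_payoff_le_one a b)).trans (h b)
  simp only [Finset.sum_const, Finset.card_univ, nsmul_eq_mul] at h1
  linarith

theorem isOptimalStrategy_of_payoffAgainst_nonpos (T : Tournament X) {p : X → ℝ}
    (hp : p ∈ stdSimplex ℝ X) (h : ∀ a, T.payoffAgainst a p ≤ 0) : T.IsOptimalStrategy p := by
  refine ⟨hp, fun q hq => ?_⟩
  rw [expectedPayoff_eq_neg_sum, neg_nonneg]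
  exact Finset.sum_nonpos fun b _ => mul_nonpos_of_nonpos_of_nonneg (h b) (hq.1 b)

section Optimal

variable [Nonempty X] (T : Tournament X)

theorem optimalStrategy_mem : T.optimalStrategy ∈ stdSimplex ℝ X :=
  T.optimalStrategy_spec.1

theorem optimalStrategy_nonneg (a : X) : 0 ≤ T.optimalStrategy a :=
  T.optimalStrategy_mem.1 a

theorem sum_optimalStrategy : ∑ a, T.optimalStrategy a = 1 :=
  T.optimalStrategy_mem.2

theorem payoffAgainst_optimalStrategy_of_ne_zero {a : X} (ha : T.optimalStrategy a ≠ 0) :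
    T.payoffAgainst a T.optimalStrategy = 0 := by
  have h := T.optimalStrategy_spec.sum_eq_zero T.optimalStrategy_spec ha
  unfold payoffAgainst
  rw [← neg_eq_zero, ← Finset.sum_neg_distrib, ← h]
  refine Finset.sum_congr rfl fun b _ => ?_
  rw [T.payoff_antisymm a b]
  push_cast
  ring

theorem payoffAgainst_optimalStrategy_nonpos (a : X) :
    T.payoffAgainst a T.optimalStrategy ≤ 0 := by
  classical
  have h := T.optimalStrategy_spec.2 _ (single_mem_stdSimplex ℝ a)
  rw [expectedPayoff_eq_neg_sum] at h
  simpa [Pi.single_apply] using h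

/-- Strict complementarity: alternatives outside the Bipartisan Set do strictly worse than the
optimal strategy. -/
theorem payoffAgainst_optimalStrategy_neg {a : X} (ha : T.optimalStrategy a = 0) :
    T.payoffAgainst a T.optimalStrategy < 0 := by
  classical
  refine lt_of_le_of_ne (T.payoffAgainst_optimalStrategy_nonpos a) fun h0 => ?_
  have hflip : ∀ b, T.payoffAgainst b T.optimalStrategy = 0 →
      ∑ x, (T.payoff x b : ℝ) * T.optimalStrategy x = 0 := by
    intro b hb
    rw [← neg_eq_zero, ← Finset.sum_neg_distrib, ← hb]
    refine Finset.sum_congr rfl fun x _ => ?_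
    rw [T.payoff_antisymm x b]
    push_cast
    ring
  -- With payoff zero at `a`, the vector `p*` lies in the kernel of the payoff matrices on `S` and
  -- on `S ∪ {a}`. One of these sets has even size, where the matrix is invertible because its
  -- determinant is odd.
  set S : Finset X := Finset.univ.filter fun x => T.optimalStrategy x ≠ 0 with hS
  have hSm : ∀ x, x ∈ S ↔ T.optimalStrategy x ≠ 0 := by simp [hS]
  have hkS : ∀ y ∈ S, ∑ x, (T.payoff x y : ℝ) * T.optimalStrategy x = 0 := fun y hy =>
    hflip y (T.payoffAgainst_optimalStrategy_of_ne_zero ((hSm y).1 hy))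
  have hz : ∀ x, T.optimalStrategy x = 0 := by
    rcases Nat.even_or_odd S.card with he | ho
    · exact T.eq_zero_of_even S he _ (fun x hx => by rw [hSm] at hx; tauto) hkS
    · have haS : a ∉ S := by rw [hSm]; tauto
      refine T.eq_zero_of_even (insert a S) ?_ _ (fun x hx => ?_) (fun y hy => ?_)
      · rw [Finset.card_insert_of_notMem haS]
        exact ho.add_one
      · have : x ∉ S := fun h => hx (Finset.mem_insert_of_mem h)
        rw [hSm] at this
        tauto
      · rcases Finset.mem_insert.1 hy with rfl | hy
        · exact hflip _ h0
        · exact hkS y hy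
  have := T.sum_optimalStrategy
  simp [hz] at this

theorem exists_payoffAgainst_optimalStrategy_le_neg :
    ∃ c : ℝ, 0 < c ∧ c ≤ 1 ∧
      ∀ a, T.optimalStrategy a = 0 → T.payoffAgainst a T.optimalStrategy ≤ -c := by
  classical
  have h : ∀ a, ∃ c : ℝ, 0 < c ∧
      (T.optimalStrategy a = 0 → T.payoffAgainst a T.optimalStrategy ≤ -c) := by
    intro a
    by_cases ha : T.optimalStrategy a = 0
    · exact ⟨-T.payoffAgainst a T.optimalStrategy,
        neg_pos.2 (T.payoffAgainst_optimalStrategy_neg ha), fun _ => by simp⟩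
    · exact ⟨1, one_pos, fun h => absurd h ha⟩
  choose c hc h using h
  obtain ⟨i, hi⟩ := Finite.exists_min c
  exact ⟨min (c i) 1, lt_min (hc i) one_pos, min_le_right _ _, fun a ha =>
    (h a ha).trans (neg_le_neg ((min_le_left _ _).trans (hi a)))⟩

theorem exists_le_optimalStrategy :
    ∃ c : ℝ, 0 < c ∧ c ≤ 1 ∧ ∀ a, T.optimalStrategy a ≠ 0 → c ≤ T.optimalStrategy a := by
  classical
  obtain ⟨i, hi⟩ := Finite.exists_min
    fun a => if T.optimalStrategy a = 0 then 1 else T.optimalStrategy a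
  refine ⟨min 1 (if T.optimalStrategy i = 0 then 1 else T.optimalStrategy i), ?_,
    min_le_left _ _, fun a ha => ?_⟩
  · refine lt_min one_pos ?_
    split_ifs with h
    · exact one_pos
    · exact lt_of_le_of_ne (T.optimalStrategy_nonneg i) (Ne.symm h)
  · have := hi a
    rw [if_neg ha] at this
    exact (min_le_right _ _).trans this

/-- If the support were a single point, strict complementarity would make that point beat every
other alternative. -/
theorem exists_ne_optimalStrategy_ne_zero (hT : ¬ T.HasCondorcetWinner) :
    ∃ a b, a ≠ b ∧ T.optimalStrategy a ≠ 0 ∧ T.optimalStrategy b ≠ 0 := by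
  classical
  obtain ⟨a, ha⟩ : ∃ a, T.optimalStrategy a ≠ 0 := by
    by_contra! h
    have := T.sum_optimalStrategy
    simp [h] at this
  by_contra! hne
  have hp : ∀ b, b ≠ a → T.optimalStrategy b = 0 := fun b hb => hne a b hb.symm ha
  have h1 : T.optimalStrategy a = 1 := by
    rw [← T.sum_optimalStrategy, Finset.sum_eq_single a (fun b _ hb => hp b hb) (by simp)]
  refine hT ⟨a, fun y hy => ?_⟩
  have h2 := T.payoffAgainst_optimalStrategy_neg (hp y hy)
  unfold payoffAgainst at h2
  rw [Finset.sum_eq_single a (fun b _ hb => by rw [hp b hb, mul_zero]) (by simp), h1,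
    mul_one] at h2
  unfold payoff at h2
  split_ifs at h2 with h3 h4
  · norm_num at h2
  · exact h4
  · norm_num at h2

/-- A rest point of the replicator dynamics at which no missing alternative is profitable is the
optimal strategy. -/
theorem eq_optimalStrategy_of_rest {p : X → ℝ} (hp : p ∈ stdSimplex ℝ X)
    (hrest : ∀ a, p a * T.payoffAgainst a p = 0)
    (h : ∀ a, p a ≠ 0 ∨ T.payoffAgainst a p ≤ 0) : p = T.optimalStrategy := by
  refine (T.isOptimalStrategy_of_payoffAgainst_nonpos hp fun a => ?_).unique
    T.optimalStrategy_spec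
  rcases h a with h | h
  · exact ((mul_eq_zero.1 (hrest a)).resolve_left h).le
  · exact h

end Optimal

end Tournament

/-! ### One step of the urn process -/

namespace Urn

theorem addBall_self {X : Type*} (n : Urn X) (x : X) : n.addBall x x = n x + 1 := by
  simp [addBall]

theorem addBall_of_ne {X : Type*} (n : Urn X) {x y : X} (h : y ≠ x) : n.addBall x y = n y := by
  simp [addBall, h]

variable {X : Type*} [Fintype X]

/-- The number of balls in an urn. -/
def total (n : Urn X) : ℕ := ∑ x, (n x : ℕ)

theorem normalized_eq (n : Urn X) (x : X) : n.normalized x = (n x : ℝ) / n.total := by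
  simp [normalized, total]

theorem le_total (n : Urn X) (x : X) : (n x : ℕ) ≤ n.total :=
  Finset.single_le_sum (f := fun y => (n y : ℕ)) (fun _ _ => Nat.zero_le _) (Finset.mem_univ x)

theorem total_addBall (n : Urn X) (x : X) : (n.addBall x).total = n.total + 1 := by
  classical
  unfold total
  rw [← Finset.add_sum_erase _ _ (Finset.mem_univ x),
    ← Finset.add_sum_erase Finset.univ (fun y => (n y : ℕ)) (Finset.mem_univ x),
    addBall_self]
  rw [Finset.sum_congr rfl fun y hy => by rw [n.addBall_of_ne (Finset.ne_of_mem_erase hy)]]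
  push_cast
  ring

theorem finite_total_eq (k : ℕ) : {n : Urn X | n.total = k}.Finite := by
  have h : (Set.pi Set.univ fun _ : X => {m : ℕ+ | (m : ℕ) ≤ k}).Finite := by
    refine Set.Finite.pi fun _ => ?_
    exact (Set.finite_Iic k).preimage PNat.coe_injective.injOn
  refine h.subset fun n hn x _ => ?_
  have h1 := le_total n x
  rw [Set.mem_ofPred_eq] at hn
  rwa [hn] at h1

section Nonempty

variable [Nonempty X]

theorem total_pos (n : Urn X) : 0 < n.total :=
  (n (Classical.arbitrary X)).pos.trans_le (n.le_total _)

theorem total_cast_pos (n : Urn X) : (0 : ℝ) < n.total := by exact_mod_cast n.total_pos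

theorem normalized_pos (n : Urn X) (x : X) : 0 < n.normalized x := by
  rw [normalized_eq]
  exact div_pos (by exact_mod_cast (n x).pos) n.total_cast_pos

theorem sum_normalized (n : Urn X) : ∑ x, n.normalized x = 1 := by
  simp only [normalized_eq]
  rw [← Finset.sum_div]
  have := n.total_cast_pos.ne'
  rw [div_eq_one_iff_eq this]
  simp [total]

theorem normalized_mem (n : Urn X) : n.normalized ∈ stdSimplex ℝ X :=
  ⟨fun x => (n.normalized_pos x).le, n.sum_normalized⟩

theorem normalized_le_one (n : Urn X) (x : X) : n.normalized x ≤ 1 := by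
  rw [← n.sum_normalized]
  exact Finset.single_le_sum (f := n.normalized) (fun y _ => (n.normalized_pos y).le)
    (Finset.mem_univ x)

theorem normalized_add_le_one (n : Urn X) {x y : X} (h : x ≠ y) :
    n.normalized x + n.normalized y ≤ 1 := by
  classical
  rw [← n.sum_normalized, ← Finset.sum_pair h]
  exact Finset.sum_le_sum_of_subset_of_nonneg (Finset.subset_univ _)
    fun z _ _ => (n.normalized_pos z).le

/-- This is the replicator form of the winning probability: payoff `g(x, ·)` tilts the current share
of `x`. -/
theorem twoAlternativesProb_eq (T : Tournament X) (n : Urn X) (x : X) :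
    n.twoAlternativesProb T x = n.normalized x * (1 + T.payoffAgainst x n.normalized) := by
  classical
  -- The winning pairs are split by which pick is `x`. The tie `a = b = x` is counted in the first
  -- summand only, since `x` does not beat itself.
  have h1 : ∀ a b, (if T.winner a b = x then n.normalized a * n.normalized b else 0)
      = (if a = x then (if T.beats b x then 0 else n.normalized x * n.normalized b) else 0)
        + (if b = x then (if T.beats x a then n.normalized x * n.normalized a else 0) else 0) := by
    intro a b
    unfold Tournament.winner
    by_cases ha : a = x <;> by_cases hb : b = x
    · subst ha; subst hb; have := T.asymm b b; by_cases h : T.beats b b <;> simp_all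
    · subst ha; by_cases h : T.beats b a <;> simp_all
    · subst hb; by_cases h : T.beats b a <;> simp_all [mul_comm]
    · by_cases h : T.beats b a <;> simp_all
  unfold twoAlternativesProb
  simp only [h1, Finset.sum_add_distrib]
  have h2 : ∑ a, ∑ b, (if a = x then
      (if T.beats b x then 0 else n.normalized x * n.normalized b) else 0)
      = ∑ b, (if T.beats b x then 0 else n.normalized x * n.normalized b) := by
    rw [Finset.sum_comm]
    simp
  rw [h2]
  simp only [Finset.sum_ite_eq', Finset.mem_univ, if_true]
  rw [← Finset.sum_add_distrib, ← n.sum_normalized, Tournament.payoffAgainst,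
    ← Finset.sum_add_distrib, Finset.mul_sum]
  refine Finset.sum_congr rfl fun b _ => ?_
  have := T.asymm x b
  unfold Tournament.payoff
  by_cases h3 : T.beats b x <;> by_cases h4 : T.beats x b <;> simp_all
  ring

theorem twoAlternativesProb_pos (T : Tournament X) (n : Urn X) (x : X) :
    0 < n.twoAlternativesProb T x := by
  classical
  have h := n.normalized_pos
  unfold twoAlternativesProb
  have hw : T.winner x x = x := by simp [Tournament.winner]
  refine Finset.sum_pos' (fun a _ => Finset.sum_nonneg fun b _ => ?_) ⟨x, Finset.mem_univ x,
    Finset.sum_pos' (fun b _ => ?_) ⟨x, Finset.mem_univ x, ?_⟩⟩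
  · split_ifs
    · exact (mul_pos (h a) (h b)).le
    · exact le_rfl
  · split_ifs
    · exact (mul_pos (h x) (h b)).le
    · exact le_rfl
  · rw [if_pos hw]
    exact mul_pos (h x) (h x)

/-- The expected value of `f` after one step of two-alternatives reinforcement from `n`. -/
noncomputable def step (T : Tournament X) (f : Urn X → ℝ) (n : Urn X) : ℝ :=
  ∑ x, n.twoAlternativesProb T x * f (n.addBall x)

theorem step_sub_const (T : Tournament X) (f : Urn X → ℝ) (c : ℝ) (n : Urn X) :
    step T (fun m => f m - c) n = step T f n - c := by
  simp only [step, mul_sub, Finset.sum_sub_distrib, ← Finset.sum_mul,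
    n.sum_twoAlternativesProb T, one_mul]

/-- Expansion around `f n`: the cross term contains the expected increment of `f`, and the remainder
is the second moment of the increment. -/
theorem step_sq_sub_const (T : Tournament X) (f : Urn X → ℝ) (c : ℝ) (n : Urn X) :
    step T (fun m => (f m - c) ^ 2) n
      = (f n - c) ^ 2 + 2 * (f n - c) * (step T f n - f n)
        + step T (fun m => (f m - f n) ^ 2) n := by
  have h1 : (f n - c) ^ 2 = ∑ x, n.twoAlternativesProb T x * (f n - c) ^ 2 := by
    rw [← Finset.sum_mul, n.sum_twoAlternativesProb T, one_mul]
  conv_rhs => rw [← step_sub_const, h1]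
  simp only [step, Finset.mul_sum, ← Finset.sum_add_distrib]
  exact Finset.sum_congr rfl fun x _ => by ring

theorem step_le_of_forall_le (T : Tournament X) {f : Urn X → ℝ} {n : Urn X} {c : ℝ}
    (h : ∀ x, f (n.addBall x) ≤ c) : step T f n ≤ c := by
  rw [← one_mul c, ← n.sum_twoAlternativesProb T, Finset.sum_mul]
  exact Finset.sum_le_sum fun x _ => mul_le_mul_of_nonneg_left (h x)
    (n.twoAlternativesProb_nonneg T x)

theorem abs_normalized_addBall_sub_le (n : Urn X) (x a : X) :
    |(n.addBall x).normalized a - n.normalized a| ≤ 1 / n.total := by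
  have hN := n.total_cast_pos
  have h1 := n.normalized_le_one a
  have h0 := (n.normalized_pos a).le
  have hn : (n a : ℝ) = n.normalized a * n.total := by
    rw [normalized_eq, div_mul_cancel₀ _ hN.ne']
  rw [normalized_eq (n.addBall x), total_addBall]
  by_cases h : a = x
  · subst h
    rw [addBall_self]
    push_cast
    rw [hn]
    have e : (n.normalized a * n.total + 1) / ((n.total : ℝ) + 1) - n.normalized a
        = (1 - n.normalized a) / ((n.total : ℝ) + 1) := by
      field_simp
      ring
    rw [e, abs_of_nonneg (div_nonneg (by linarith) (by linarith))]
    apply div_le_div₀ <;> linarith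
  · rw [n.addBall_of_ne h]
    push_cast
    rw [hn]
    have e : (n.normalized a * n.total) / ((n.total : ℝ) + 1) - n.normalized a
        = - (n.normalized a / ((n.total : ℝ) + 1)) := by
      field_simp
      ring
    rw [e, abs_neg, abs_of_nonneg (div_nonneg h0 (by linarith))]
    apply div_le_div₀ <;> linarith

theorem step_normalized (T : Tournament X) (n : Urn X) (a : X) :
    step T (fun m => m.normalized a) n
      = n.normalized a + n.normalized a * T.payoffAgainst a n.normalized / (n.total + 1) := by
  classical
  have hN := n.total_cast_pos
  have h : ∀ x, (n.addBall x).normalized a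
      = (n a : ℝ) / (n.total + 1) + (if x = a then 1 else 0) / (n.total + 1) := by
    intro x
    rw [normalized_eq, total_addBall]
    by_cases h : x = a
    · subst h
      rw [addBall_self, if_pos rfl]
      push_cast
      ring
    · rw [n.addBall_of_ne (Ne.symm h), if_neg h]
      push_cast
      ring
  simp only [step, h, mul_add, Finset.sum_add_distrib, ← Finset.sum_mul,
    n.sum_twoAlternativesProb T]
  have h2 : ∑ x, n.twoAlternativesProb T x * ((if x = a then 1 else 0) / ((n.total : ℝ) + 1))
      = n.twoAlternativesProb T a / (n.total + 1) := by
    rw [Finset.sum_eq_single a (fun b _ hb => by simp [hb]) (by simp)]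
    simp [div_eq_mul_inv]
  rw [h2, twoAlternativesProb_eq, normalized_eq]
  field_simp
  ring

end Nonempty

end Urn

/-! ### Relative entropy and the gap -/

/-- The relative entropy of `p` with respect to `q`. -/
noncomputable def relEntropy {X : Type*} [Fintype X] (p q : X → ℝ) : ℝ :=
  ∑ a, p a * (Real.log (p a) - Real.log (q a))

/-- A weak Pinsker inequality through the Hellinger distance: `log t ≤ t - 1` at `t = √(q / p)`
bounds each `(√p - √q) ^ 2` by an entropy term, and `(q - p) ^ 2 = (√p - √q) ^ 2 (√p + √q) ^ 2` with
last factor at most `4`. -/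
theorem sq_sub_le_four_mul_relEntropy {X : Type*} [Fintype X] {p q : X → ℝ}
    (hp : p ∈ stdSimplex ℝ X) (hq : q ∈ stdSimplex ℝ X) (h : ∀ a, p a ≠ 0 → 0 < q a) (a : X) :
    (q a - p a) ^ 2 ≤ 4 * relEntropy p q := by
  have hterm : ∀ b, (√(p b) - √(q b)) ^ 2
      ≤ p b * (Real.log (p b) - Real.log (q b)) + q b - p b := by
    intro b
    have e : (√(p b) - √(q b)) ^ 2 = p b + q b - 2 * (√(p b) * √(q b)) := by
      rw [sub_sq, Real.sq_sqrt (hp.1 b), Real.sq_sqrt (hq.1 b)]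
      ring
    rw [e]
    by_cases hb : p b = 0
    · simp [hb]
    · have hpb : 0 < p b := lt_of_le_of_ne (hp.1 b) (Ne.symm hb)
      have hqb := h b hb
      have h1 := Real.log_le_sub_one_of_pos (x := √(q b) / √(p b)) (by positivity)
      rw [Real.log_div (by positivity) (by positivity), Real.log_sqrt hqb.le,
        Real.log_sqrt hpb.le] at h1
      have h2 : p b * (√(q b) / √(p b)) = √(p b) * √(q b) := by
        nth_rewrite 1 [← Real.mul_self_sqrt hpb.le]
        field_simp
      have h3 := mul_le_mul_of_nonneg_left h1 hpb.le
      rw [mul_sub, mul_sub, h2] at h3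
      nlinarith
  have h1 : (√(p a) - √(q a)) ^ 2 ≤ relEntropy p q := by
    calc (√(p a) - √(q a)) ^ 2 ≤ ∑ b, (√(p b) - √(q b)) ^ 2 :=
          Finset.single_le_sum (f := fun b => (√(p b) - √(q b)) ^ 2)
            (fun b _ => sq_nonneg _) (Finset.mem_univ a)
      _ ≤ ∑ b, (p b * (Real.log (p b) - Real.log (q b)) + q b - p b) :=
          Finset.sum_le_sum fun b _ => hterm b
      _ = relEntropy p q := by
          rw [Finset.sum_sub_distrib, Finset.sum_add_distrib, hp.2, hq.2, relEntropy]
          ring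
  have hle : ∀ {r : X → ℝ}, r ∈ stdSimplex ℝ X → √(r a) ≤ 1 := by
    intro r hr
    rw [Real.sqrt_le_one]
    rw [← hr.2]
    exact Finset.single_le_sum (fun b _ => hr.1 b) (Finset.mem_univ a)
  have h2 := hle hp
  have h3 := hle hq
  have h4 := Real.sqrt_nonneg (p a)
  have h5 := Real.sqrt_nonneg (q a)
  have e : (q a - p a) ^ 2 = (√(p a) - √(q a)) ^ 2 * (√(p a) + √(q a)) ^ 2 := by
    rw [← mul_pow, ← Real.sq_sqrt (hp.1 a), ← Real.sq_sqrt (hq.1 a),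
      Real.sqrt_sq h4, Real.sqrt_sq h5]
    ring
  have h6 : (√(p a) + √(q a)) ^ 2 ≤ 4 := by nlinarith
  rw [e]
  nlinarith [sq_nonneg (√(p a) - √(q a)), sq_nonneg (√(p a) + √(q a))]

theorem relEntropy_self {X : Type*} [Fintype X] (p : X → ℝ) : relEntropy p p = 0 := by
  simp [relEntropy]

theorem relEntropy_pos {X : Type*} [Fintype X] {p q : X → ℝ} (hp : p ∈ stdSimplex ℝ X)
    (hq : q ∈ stdSimplex ℝ X) (h : ∀ a, p a ≠ 0 → 0 < q a) (hne : q ≠ p) :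
    0 < relEntropy p q := by
  obtain ⟨a, ha⟩ := Function.ne_iff.1 hne
  have h1 := sq_sub_le_four_mul_relEntropy hp hq h a
  have h2 : 0 < (q a - p a) ^ 2 := by
    have := sub_ne_zero.2 ha
    positivity
  linarith

namespace Urn

theorem harmonicDefect_sub_nonneg {X : Type*} [Fintype X] (n : Urn X) (a : X) :
    0 ≤ harmonicDefect n.total - harmonicDefect (n a) := by
  refine le_trans ?_ (harmonicDefect_sub_ge (n a).pos (n.le_total a))
  have : ((n.total : ℝ))⁻¹ ≤ ((n a : ℕ) : ℝ)⁻¹ :=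
    inv_anti₀ (by exact_mod_cast (n a).pos) (by exact_mod_cast n.le_total a)
  linarith

variable {X : Type*} [Fintype X] [Nonempty X] (T : Tournament X) (n : Urn X)

/-- A Lyapunov function of two-alternatives reinforcement: up to a discretization term it is the
relative entropy of the optimal strategy with respect to the composition of the urn. -/
noncomputable def gap : ℝ :=
  ∑ a, T.optimalStrategy a *
    (Real.log (T.optimalStrategy a) + harmonicBelow n.total - harmonicBelow (n a))

/-- The share of the balls whose colours are outside the Bipartisan Set. -/
noncomputable def outsideShare : ℝ :=
  open Classical in ∑ a, if T.optimalStrategy a = 0 then n.normalized a else 0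

/-- The second sum is the price of using harmonic sums instead of logarithms. It is nonnegative
because `harmonicDefect` increases. -/
theorem gap_eq : n.gap T = relEntropy T.optimalStrategy n.normalized
    + ∑ a, T.optimalStrategy a * (harmonicDefect n.total - harmonicDefect (n a)) := by
  unfold gap relEntropy
  rw [← Finset.sum_add_distrib]
  refine Finset.sum_congr rfl fun a _ => ?_
  rw [normalized_eq, Real.log_div (by exact_mod_cast (n a).ne_zero) n.total_cast_pos.ne',
    harmonicDefect, harmonicDefect]
  ring

theorem relEntropy_le_gap : relEntropy T.optimalStrategy n.normalized ≤ n.gap T := by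
  rw [gap_eq]
  have : 0 ≤ ∑ a, T.optimalStrategy a * (harmonicDefect n.total - harmonicDefect (n a)) :=
    Finset.sum_nonneg fun a _ =>
      mul_nonneg (T.optimalStrategy_nonneg a) (n.harmonicDefect_sub_nonneg a)
  linarith

theorem sq_normalized_sub_le_gap (a : X) :
    (n.normalized a - T.optimalStrategy a) ^ 2 ≤ 4 * n.gap T :=
  (sq_sub_le_four_mul_relEntropy T.optimalStrategy_mem n.normalized_mem
    (fun b _ => n.normalized_pos b) a).trans
    (mul_le_mul_of_nonneg_left (n.relEntropy_le_gap T) (by norm_num))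

theorem gap_nonneg : 0 ≤ n.gap T := by
  have := n.sq_normalized_sub_le_gap T (Classical.arbitrary X)
  nlinarith [sq_nonneg (n.normalized (Classical.arbitrary X)
    - T.optimalStrategy (Classical.arbitrary X))]

/-- The discretization correction alone keeps the gap from being small compared with `1 / N` while a
colour other than `a` has a substantial share: `1 / n(a) - 1 / N = (1 / x(a) - 1) / N ≥ (1 - x(a)) /
N ≥ x(b) / N`. -/
theorem div_total_le_gap {a b : X} (hab : a ≠ b) :
    T.optimalStrategy a * n.normalized b / (6 * n.total) ≤ n.gap T := by
  have hp := T.optimalStrategy_nonneg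
  have hN := n.total_cast_pos
  have h0 : 0 ≤ relEntropy T.optimalStrategy n.normalized := by
    have := sq_sub_le_four_mul_relEntropy T.optimalStrategy_mem n.normalized_mem
      (fun b _ => n.normalized_pos b) a
    nlinarith [sq_nonneg (n.normalized a - T.optimalStrategy a)]
  have h1 : T.optimalStrategy a * (harmonicDefect n.total - harmonicDefect (n a)) ≤ n.gap T := by
    have := Finset.single_le_sum
      (f := fun a => T.optimalStrategy a * (harmonicDefect n.total - harmonicDefect (n a)))
      (fun b _ => mul_nonneg (hp b) (n.harmonicDefect_sub_nonneg b)) (Finset.mem_univ a)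
    rw [gap_eq]
    linarith
  refine le_trans ?_ h1
  rw [mul_div_assoc]
  refine mul_le_mul_of_nonneg_left
    (le_trans ?_ (harmonicDefect_sub_ge (n a).pos (n.le_total a))) (hp a)
  have h2 := n.normalized_add_le_one hab
  have hxa := n.normalized_pos a
  have hxa1 := n.normalized_le_one a
  have hn : ((n a : ℕ) : ℝ)⁻¹ = (n.normalized a)⁻¹ * (n.total : ℝ)⁻¹ := by
    rw [normalized_eq, inv_div]
    field_simp
  rw [hn]
  have h3 : 1 - n.normalized a ≤ (n.normalized a)⁻¹ - 1 := by
    have : 2 ≤ n.normalized a + (n.normalized a)⁻¹ := by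
      have e : n.normalized a + (n.normalized a)⁻¹ - 2
          = (n.normalized a - 1) ^ 2 / n.normalized a := by
        field_simp
        ring
      have : 0 ≤ (n.normalized a - 1) ^ 2 / n.normalized a := by positivity
      linarith
    linarith
  have e1 : n.normalized b / (6 * n.total) = n.normalized b * (1 / 6 * (n.total : ℝ)⁻¹) := by
    field_simp
  have e2 : 1 / 6 * ((n.normalized a)⁻¹ * (n.total : ℝ)⁻¹ - (n.total : ℝ)⁻¹)
      = ((n.normalized a)⁻¹ - 1) * (1 / 6 * (n.total : ℝ)⁻¹) := by ring
  rw [e1, e2]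
  exact mul_le_mul_of_nonneg_right (by linarith) (by positivity)

/-- This is what the harmonic sums in `gap` are for: passing from `k` to `k + 1` adds exactly `1 /
k`, so there is no Taylor remainder. -/
theorem gap_addBall (x : X) :
    (n.addBall x).gap T = n.gap T + (1 / n.total - T.optimalStrategy x / (n x : ℕ)) := by
  classical
  have h : ∀ a, T.optimalStrategy a * (Real.log (T.optimalStrategy a)
      + harmonicBelow (n.addBall x).total - harmonicBelow (n.addBall x a))
      = T.optimalStrategy a * (Real.log (T.optimalStrategy a)
          + harmonicBelow n.total - harmonicBelow (n a))
        + (T.optimalStrategy a * (1 / n.total)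
          - if a = x then T.optimalStrategy x / (n x : ℕ) else 0) := by
    intro a
    rw [total_addBall, harmonicBelow_succ]
    by_cases hax : a = x
    · subst hax
      rw [addBall_self, PNat.add_coe, PNat.one_coe, harmonicBelow_succ, if_pos rfl]
      ring
    · rw [n.addBall_of_ne hax, if_neg hax]
      ring
  unfold gap
  simp only [h, Finset.sum_add_distrib, Finset.sum_sub_distrib, ← Finset.sum_mul,
    T.sum_optimalStrategy]
  simp

/-- The share in the winning probability cancels against `p*(x) / n(x)`, leaving `p*(x) (1 + g(x,
·)) / N`. The constant parts sum to `1 / N` and cancel. -/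
theorem step_gap :
    step T (gap T) n = n.gap T - T.expectedPayoff T.optimalStrategy n.normalized / n.total := by
  have hN := n.total_cast_pos.ne'
  have h : ∀ x, n.twoAlternativesProb T x * (n.addBall x).gap T
      = n.twoAlternativesProb T x * (n.gap T + 1 / n.total)
        - (T.optimalStrategy x + T.optimalStrategy x * T.payoffAgainst x n.normalized)
          / n.total := by
    intro x
    have hx : (n x : ℝ) ≠ 0 := by exact_mod_cast (n x).ne_zero
    rw [gap_addBall]
    have e : n.twoAlternativesProb T x * (T.optimalStrategy x / (n x : ℕ))
        = (T.optimalStrategy x + T.optimalStrategy x * T.payoffAgainst x n.normalized)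
          / n.total := by
      rw [twoAlternativesProb_eq, normalized_eq]
      field_simp
    rw [← e]
    ring
  unfold step
  rw [Finset.sum_congr rfl fun x _ => h x, Finset.sum_sub_distrib, ← Finset.sum_mul,
    n.sum_twoAlternativesProb T, ← Finset.sum_div, Finset.sum_add_distrib, T.sum_optimalStrategy,
    T.expectedPayoff_eq_sum_payoffAgainst]
  ring

theorem outsideShare_nonneg : 0 ≤ n.outsideShare T := by
  classical
  refine Finset.sum_nonneg fun a _ => ?_
  split_ifs
  · exact (n.normalized_pos a).le
  · exact le_rfl

theorem normalized_le_outsideShare {a : X} (ha : T.optimalStrategy a = 0) :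
    n.normalized a ≤ n.outsideShare T := by
  classical
  have h := Finset.single_le_sum
    (f := fun a => if T.optimalStrategy a = 0 then n.normalized a else 0)
    (fun b _ => by
      split_ifs
      · exact (n.normalized_pos b).le
      · exact le_rfl) (Finset.mem_univ a)
  rw [if_pos ha] at h
  unfold outsideShare
  convert h

/-- Alternatives in the support have payoff zero against `p*`, so only outside colours contribute to
`g(p*, ·)`, each at least `c` times its share. -/
theorem mul_outsideShare_le_expectedPayoff {c : ℝ}
    (hc : ∀ a, T.optimalStrategy a = 0 → T.payoffAgainst a T.optimalStrategy ≤ -c) :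
    c * n.outsideShare T ≤ T.expectedPayoff T.optimalStrategy n.normalized := by
  classical
  rw [T.expectedPayoff_eq_neg_sum, outsideShare, Finset.mul_sum, ← Finset.sum_neg_distrib]
  refine Finset.sum_le_sum fun a _ => ?_
  have hx := n.normalized_pos a
  split_ifs with ha
  · nlinarith [hc a ha]
  · rw [T.payoffAgainst_optimalStrategy_of_ne_zero ha]
    simp

theorem expectedPayoff_le_outsideShare :
    T.expectedPayoff T.optimalStrategy n.normalized ≤ n.outsideShare T := by
  classical
  rw [T.expectedPayoff_eq_neg_sum, outsideShare, ← Finset.sum_neg_distrib]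
  refine Finset.sum_le_sum fun a _ => ?_
  have hx := n.normalized_pos a
  split_ifs with ha
  · have := (abs_le.1 (T.abs_payoffAgainst_le_one a T.optimalStrategy_mem)).1
    nlinarith
  · rw [T.payoffAgainst_optimalStrategy_of_ne_zero ha]
    simp

theorem expectedPayoff_normalized_nonneg :
    0 ≤ T.expectedPayoff T.optimalStrategy n.normalized :=
  T.optimalStrategy_spec.2 _ n.normalized_mem

theorem step_outsideShare_le {c : ℝ}
    (hc : ∀ a, T.optimalStrategy a = 0 → T.payoffAgainst a n.normalized ≤ -c) :
    step T (outsideShare T) n ≤ n.outsideShare T - c * n.outsideShare T / (n.total + 1) := by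
  classical
  have hN := n.total_cast_pos
  have h1 : step T (outsideShare T) n
      = ∑ a, if T.optimalStrategy a = 0 then step T (fun m => m.normalized a) n else 0 := by
    unfold step outsideShare
    simp only [Finset.mul_sum]
    rw [Finset.sum_comm]
    refine Finset.sum_congr rfl fun a _ => ?_
    split_ifs with ha <;> simp
  rw [h1]
  unfold outsideShare
  rw [Finset.mul_sum, Finset.sum_div, ← Finset.sum_sub_distrib]
  refine Finset.sum_le_sum fun a _ => ?_
  split_ifs with ha
  · rw [step_normalized]
    have h2 : n.normalized a * T.payoffAgainst a n.normalized / (n.total + 1)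
        ≤ - (c * n.normalized a / (n.total + 1)) := by
      rw [← neg_div]
      refine div_le_div_of_nonneg_right ?_ (by linarith)
      nlinarith [hc a ha, n.normalized_pos a]
    linarith
  · simp

theorem abs_normalized_sub_le {ε : ℝ} (hε : 0 ≤ ε) (h : 4 * n.gap T ≤ ε ^ 2) (a : X) :
    |n.normalized a - T.optimalStrategy a| ≤ ε :=
  abs_le_of_sq_le_sq ((n.sq_normalized_sub_le_gap T a).trans h) hε

theorem half_le_normalized {c : ℝ} (hc : 0 < c) (h : 16 * n.gap T ≤ c ^ 2) {a : X}
    (ha : c ≤ T.optimalStrategy a) : c / 2 ≤ n.normalized a := by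
  have := (abs_le.1 (n.abs_normalized_sub_le T (ε := c / 2) (by linarith) (by linarith) a)).1
  linarith

theorem sq_gap_addBall_sub (x : X) : ((n.addBall x).gap T - n.gap T) ^ 2
    = (n.normalized x - T.optimalStrategy x) ^ 2 / (n.normalized x ^ 2 * n.total ^ 2) := by
  have hN := n.total_cast_pos.ne'
  have hx : (n x : ℝ) ≠ 0 := by exact_mod_cast (n x).ne_zero
  rw [gap_addBall, normalized_eq]
  field_simp
  ring

/-- A colour outside the support changes the gap by exactly `1 / N`. For a colour in the support,
`|x - p*| ≤ c / 2 ≤ x` near `p*`, so the change is no larger. -/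
theorem step_sq_gap_sub_le {c : ℝ} (hc : 0 < c) (hp : ∀ a, T.optimalStrategy a ≠ 0 →
    c ≤ T.optimalStrategy a) (h : 16 * n.gap T ≤ c ^ 2) :
    step T (fun m => (m.gap T - n.gap T) ^ 2) n ≤ 1 / n.total ^ 2 := by
  refine step_le_of_forall_le T fun x => ?_
  have hN := n.total_cast_pos
  have hx := n.normalized_pos x
  rw [sq_gap_addBall_sub, div_le_div_iff₀ (by positivity) (by positivity), one_mul]
  refine mul_le_mul_of_nonneg_right ?_ (by positivity)
  by_cases h0 : T.optimalStrategy x = 0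
  · simp [h0]
  · have h1 := n.half_le_normalized T hc h (hp x h0)
    have h2 := n.sq_normalized_sub_le_gap T x
    nlinarith

/-- With full support every increment vanishes to first order at `p*`, so the noise decreases with
the gap. The constant is `4 / (c / 2) ^ 2`. -/
theorem step_sq_gap_sub_le_mul_gap {c : ℝ} (hc : 0 < c) (hp : ∀ a, c ≤ T.optimalStrategy a)
    (h : 16 * n.gap T ≤ c ^ 2) :
    step T (fun m => (m.gap T - n.gap T) ^ 2) n ≤ 16 / c ^ 2 * n.gap T / n.total ^ 2 := by
  refine step_le_of_forall_le T fun x => ?_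
  have hN := n.total_cast_pos
  have hx := n.normalized_pos x
  have h1 := n.half_le_normalized T hc h (hp x)
  have h2 := n.sq_normalized_sub_le_gap T x
  have h3 : c ^ 2 / 4 ≤ n.normalized x ^ 2 := by nlinarith
  rw [sq_gap_addBall_sub, ← div_div]
  refine div_le_div_of_nonneg_right ?_ (by positivity)
  calc (n.normalized x - T.optimalStrategy x) ^ 2 / n.normalized x ^ 2
      ≤ 4 * n.gap T / (c ^ 2 / 4) :=
        div_le_div₀ (by linarith [n.gap_nonneg T]) h2 (by positivity) h3
    _ = 16 / c ^ 2 * n.gap T := by field_simp; ring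

/-- All terms `-p*(b) log x(b)` of the relative entropy are nonnegative, so a bound on the gap
bounds each of them. Hence a bounded gap keeps the shares of the support away from zero. -/
theorem exp_le_normalized {K : ℝ} (hK : n.gap T ≤ K) {a : X} (ha : T.optimalStrategy a ≠ 0) :
    Real.exp (-(K - ∑ b, T.optimalStrategy b * Real.log (T.optimalStrategy b))
      / T.optimalStrategy a) ≤ n.normalized a := by
  have hp : 0 < T.optimalStrategy a := lt_of_le_of_ne (T.optimalStrategy_nonneg a) (Ne.symm ha)
  have h1 := (n.relEntropy_le_gap T).trans hK
  have h2 : T.optimalStrategy a * -Real.log (n.normalized a)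
      ≤ ∑ b, T.optimalStrategy b * -Real.log (n.normalized b) :=
    Finset.single_le_sum (f := fun b => T.optimalStrategy b * -Real.log (n.normalized b))
      (fun b _ => mul_nonneg (T.optimalStrategy_nonneg b)
        (neg_nonneg.2 (Real.log_nonpos (n.normalized_pos b).le (n.normalized_le_one b))))
      (Finset.mem_univ a)
  have h3 : relEntropy T.optimalStrategy n.normalized
      = ∑ b, T.optimalStrategy b * Real.log (T.optimalStrategy b)
        + ∑ b, T.optimalStrategy b * -Real.log (n.normalized b) := by
    rw [relEntropy, ← Finset.sum_add_distrib]
    exact Finset.sum_congr rfl fun b _ => by ring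
  rw [← Real.le_log_iff_exp_le (n.normalized_pos a), div_le_iff₀ hp]
  linarith

/-- The discretization correction disappears in the limit: on the support both `N` and `n(a)` tend
to infinity, so both defects tend to the Euler–Mascheroni constant. -/
theorem tendsto_gap {ι : Type*} {l : Filter ι} {m : ι → Urn X} {q : X → ℝ}
    (hN : Tendsto (fun i => (m i).total) l atTop)
    (hm : Tendsto (fun i => (m i).normalized) l (𝓝 q))
    (hq : ∀ a, T.optimalStrategy a ≠ 0 → 0 < q a) :
    Tendsto (fun i => (m i).gap T) l (𝓝 (relEntropy T.optimalStrategy q)) := by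
  simp only [gap_eq, relEntropy, ← Finset.sum_add_distrib]
  refine tendsto_finsetSum _ fun a _ => ?_
  by_cases ha : T.optimalStrategy a = 0
  · simp [ha, tendsto_const_nhds]
  have hma : Tendsto (fun i => (m i).normalized a) l (𝓝 (q a)) := (tendsto_pi_nhds.1 hm) a
  have hlog := hma.log (hq a ha).ne'
  have hna : Tendsto (fun i => (m i a : ℕ)) l atTop := by
    rw [← tendsto_natCast_atTop_iff (R := ℝ)]
    refine (Tendsto.pos_mul_atTop (hq a ha) hma
      (tendsto_natCast_atTop_iff (R := ℝ).2 hN)).congr fun i => ?_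
    rw [normalized_eq, div_mul_cancel₀ _ (m i).total_cast_pos.ne']
  have h1 := (tendsto_harmonicDefect.comp hN).sub (tendsto_harmonicDefect.comp hna)
  have h2 := ((tendsto_const_nhds (x := Real.log (T.optimalStrategy a))).sub hlog).const_mul
    (T.optimalStrategy a) |>.add (h1.const_mul (T.optimalStrategy a))
  simpa using h2

end Urn

/-! ### Histories and the Markov property -/

section Filtration

variable {X : Type*} {Ω : Type*}

/-- The first `τ + 1` urns of the urn sequence `U`. -/
def urnHistory (U : ℕ → Ω → Urn X) (τ : ℕ) (ω : Ω) : Fin (τ + 1) → Urn X :=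
  fun i => U i ω

theorem urnHistory_eq_iff (U : ℕ → Ω → Urn X) (τ : ℕ) (ω : Ω) (h : ℕ → Urn X) :
    urnHistory U τ ω = (fun i : Fin (τ + 1) => h i) ↔ ∀ i ≤ τ, U i ω = h i := by
  rw [funext_iff]
  exact ⟨fun H i hi => H ⟨i, Nat.lt_succ_of_le hi⟩, fun H i => H i (Nat.le_of_lt_succ i.2)⟩

theorem exists_history_extension (τ : ℕ) (h : Fin (τ + 1) → Urn X) :
    ∃ h' : ℕ → Urn X, h = fun i : Fin (τ + 1) => h' i :=
  ⟨fun i => h ⟨min i τ, by omega⟩, by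
    ext1 i
    congr 1
    ext
    simp only
    omega⟩

variable [Fintype X] [m : MeasurableSpace Ω]

/-- The natural filtration of an urn sequence. -/
def urnFiltration {U : ℕ → Ω → Urn X} (hU : ∀ τ n, MeasurableSet {ω | U τ ω = n}) :
    Filtration ℕ m where
  seq τ := MeasurableSpace.comap (urnHistory U τ) ⊤
  mono' := by
    rintro s t hst _ ⟨S, -, rfl⟩
    exact ⟨{h | (fun i : Fin (s + 1) => h ⟨i, by omega⟩) ∈ S}, trivial, rfl⟩
  le' := by
    rintro τ _ ⟨S, -, rfl⟩
    have : urnHistory U τ ⁻¹' S = ⋃ h ∈ S, ⋂ i : Fin (τ + 1), {ω | U i ω = h i} := by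
      ext ω
      simp only [Set.mem_preimage, Set.mem_iUnion, Set.mem_iInter, exists_prop]
      exact ⟨fun h => ⟨_, h, fun i => rfl⟩, fun ⟨h, hS, H⟩ => by
        rwa [show urnHistory U τ ω = h from funext H]⟩
    rw [this]
    exact MeasurableSet.biUnion (Set.to_countable S) fun h _ =>
      MeasurableSet.iInter fun i => hU _ _

variable {U : ℕ → Ω → Urn X} (hU : ∀ τ n, MeasurableSet {ω | U τ ω = n})

theorem measurable_urnFiltration {β : Type*} [MeasurableSpace β] {s τ : ℕ} (hs : s ≤ τ)
    (f : Urn X → β) : Measurable[urnFiltration hU τ] fun ω => f (U s ω) := by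
  intro S _
  exact ⟨{h | f (h ⟨s, Nat.lt_succ_of_le hs⟩) ∈ S}, trivial, rfl⟩

theorem measurable_urn (hU : ∀ τ n, MeasurableSet {ω | U τ ω = n}) {β : Type*} [MeasurableSpace β] (f : Urn X → β) (τ : ℕ) :
    Measurable fun ω => f (U τ ω) :=
  (measurable_urnFiltration hU le_rfl f).mono ((urnFiltration hU).le τ) le_rfl

end Filtration

namespace IsTwoAlternativesReinforcement

variable {X : Type*} [Fintype X] {T : Tournament X} {n₀ : Urn X}
  {Ω : Type*} [MeasurableSpace Ω] {P : Measure Ω}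
  {U : ℕ → Ω → Urn X}

/-- The natural filtration of two-alternatives reinforcement. -/
abbrev filtration (hU : IsTwoAlternativesReinforcement T n₀ P U) : Filtration ℕ ‹_› :=
  urnFiltration hU.measurableSet

theorem measurableSet_cylinder (hU : IsTwoAlternativesReinforcement T n₀ P U) (τ : ℕ)
    (h : ℕ → Urn X) : MeasurableSet[hU.filtration τ] {ω | ∀ i ≤ τ, U i ω = h i} :=
  ⟨{fun i : Fin (τ + 1) => h i}, trivial, by
    ext ω
    exact urnHistory_eq_iff U τ ω h⟩

/-- The Markov property: after a history of positive probability the process starts afresh. -/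
theorem cond_cylinder (hU : IsTwoAlternativesReinforcement T n₀ P U) (s : ℕ) (h : ℕ → Urn X) :
    IsTwoAlternativesReinforcement T (h s) (P[|{ω | ∀ i ≤ s, U i ω = h i}])
      (fun τ => U (s + τ)) := by
  have hmc : ∀ (τ : ℕ) (h : ℕ → Urn X), MeasurableSet {ω | ∀ i ≤ τ, U i ω = h i} :=
    fun τ h => hU.filtration.le τ _ (hU.measurableSet_cylinder τ h)
  refine ⟨fun τ n => hU.measurableSet _ _, ?_, fun τ k x => ?_⟩
  · filter_upwards [ae_cond_mem (hmc s h)] with ω hω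
    exact hω s le_rfl
  · rw [cond_apply (hmc s h), cond_apply (hmc s h), mul_assoc]
    congr 1
    -- If the two histories fit together, the step rule is applied to their concatenation. Otherwise
    -- both events are empty.
    by_cases h0 : k 0 = h s
    · have key : {ω | ∀ i ≤ s, U i ω = h i} ∩ {ω | ∀ i ≤ τ, U (s + i) ω = k i}
          = {ω | ∀ i ≤ s + τ, U i ω = if i ≤ s then h i else k (i - s)} := by
        ext ω
        constructor
        · rintro ⟨h1, h2⟩ i hi
          split_ifs with his
          · exact h1 i his
          · have := h2 (i - s) (by omega)
            rwa [Nat.add_sub_cancel' (by omega)] at this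
        · intro H
          refine ⟨fun i hi => by simpa [hi] using H i (by omega), fun i hi => ?_⟩
          have := H (s + i) (by omega)
          rw [this]
          split_ifs with h3
          · have : i = 0 := by omega
            subst this
            exact h0.symm
          · rw [Nat.add_sub_cancel_left]
      have hlast : (if s + τ ≤ s then h (s + τ) else k (s + τ - s)) = k τ := by
        split_ifs with h3
        · have : τ = 0 := by omega
          subst this
          exact h0.symm
        · rw [Nat.add_sub_cancel_left]
      have := hU.step (s + τ) (fun i => if i ≤ s then h i else k (i - s)) x
      simp only [hlast] at this
      rw [← key] at this
      rw [← this]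
      congr 1
      ext ω
      have hk := Set.ext_iff.1 key ω
      simp only [Set.mem_inter_iff, Set.mem_ofPred_eq] at hk ⊢
      rw [← hk, and_assoc, add_assoc]
    · have e : ∀ A : Set Ω, A ⊆ {ω | ∀ i ≤ τ, U (s + i) ω = k i} →
          {ω | ∀ i ≤ s, U i ω = h i} ∩ A = ∅ := by
        intro A hA
        rw [Set.eq_empty_iff_forall_notMem]
        rintro ω ⟨h1, h2⟩
        exact h0 ((hA h2 0 (Nat.zero_le _)).symm.trans (h1 s le_rfl))
      rw [e _ subset_rfl, e _ (fun ω hω => hω.1)]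
      simp

variable [Nonempty X] [IsProbabilityMeasure P]

/-- The one-ball continuations of a history are disjoint, and their probabilities add up to that of
the history. -/
theorem cylinder_ae_eq (hU : IsTwoAlternativesReinforcement T n₀ P U) (τ : ℕ) (h : ℕ → Urn X) :
    (⋃ x, {ω | (∀ i ≤ τ, U i ω = h i) ∧ U (τ + 1) ω = (h τ).addBall x} : Set Ω)
      =ᵐ[P] {ω | ∀ i ≤ τ, U i ω = h i} := by
  have hm : ∀ x, MeasurableSet {ω | (∀ i ≤ τ, U i ω = h i) ∧ U (τ + 1) ω = (h τ).addBall x} :=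
    fun x => (hU.filtration.le τ _ (hU.measurableSet_cylinder τ h)).inter (hU.measurableSet _ _)
  refine ae_eq_of_subset_of_measure_ge (Set.iUnion_subset fun x ω hω => hω.1) ?_
    (MeasurableSet.iUnion hm).nullMeasurableSet (measure_ne_top _ _)
  rw [measure_iUnion (fun x y hxy => Set.disjoint_left.2 fun ω h1 h2 =>
    hxy ((h τ).addBall_injective (h1.2.symm.trans h2.2))) hm, tsum_fintype]
  simp only [hU.step]
  rw [← Finset.mul_sum, ← ENNReal.ofReal_sum_of_nonneg
    fun x _ => (h τ).twoAlternativesProb_nonneg T x, (h τ).sum_twoAlternativesProb T]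
  simp

theorem ae_exists_eq_addBall (hU : IsTwoAlternativesReinforcement T n₀ P U) :
    ∀ᵐ ω ∂P, ∀ τ, ∃ x, U (τ + 1) ω = (U τ ω).addBall x := by
  rw [ae_all_iff]
  intro τ
  have key : ∀ᵐ ω ∂P, ∀ h : Fin (τ + 1) → Urn X, urnHistory U τ ω = h →
      ∃ x, U (τ + 1) ω = (U τ ω).addBall x := by
    rw [ae_all_iff]
    intro h
    obtain ⟨h', rfl⟩ := exists_history_extension τ h
    filter_upwards [hU.cylinder_ae_eq τ h'] with ω hω hω'
    rw [urnHistory_eq_iff] at hω'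
    obtain ⟨x, hx⟩ := Set.mem_iUnion.1 (hω.mpr hω')
    exact ⟨x, by rw [hω' τ le_rfl]; exact hx.2⟩
  filter_upwards [key] with ω hω
  exact hω _ rfl

theorem ae_total_eq (hU : IsTwoAlternativesReinforcement T n₀ P U) :
    ∀ᵐ ω ∂P, ∀ τ, (U τ ω).total = n₀.total + τ := by
  filter_upwards [hU.ae_exists_eq_addBall, hU.initial] with ω h1 h0 τ
  induction τ with
  | zero => rw [h0, add_zero]
  | succ τ ih =>
    obtain ⟨x, hx⟩ := h1 τ
    rw [hx, Urn.total_addBall, ih, add_assoc]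

/-- At a fixed time the number of balls is almost surely determined, so only finitely many urns
occur and every function of the urn is bounded. -/
theorem exists_bound (hU : IsTwoAlternativesReinforcement T n₀ P U) (f : Urn X → ℝ) (τ : ℕ) :
    ∃ C, ∀ᵐ ω ∂P, ‖f (U τ ω)‖ ≤ C := by
  obtain ⟨C, hC⟩ := ((Urn.finite_total_eq (X := X) (n₀.total + τ)).image
    fun n => ‖f n‖).bddAbove
  refine ⟨C, ?_⟩
  filter_upwards [hU.ae_total_eq] with ω hω
  exact hC ⟨_, hω τ, rfl⟩

theorem integrable (hU : IsTwoAlternativesReinforcement T n₀ P U) (f : Urn X → ℝ) (τ : ℕ) :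
    Integrable (fun ω => f (U τ ω)) P := by
  obtain ⟨C, hC⟩ := hU.exists_bound f τ
  exact Integrable.of_bound (measurable_urn hU.measurableSet f τ).aestronglyMeasurable C hC

theorem setIntegral_cylinder_succ (hU : IsTwoAlternativesReinforcement T n₀ P U)
    (f : Urn X → ℝ) (τ : ℕ) (h : ℕ → Urn X) :
    ∫ ω in {ω | ∀ i ≤ τ, U i ω = h i}, f (U (τ + 1) ω) ∂P
      = ∫ ω in {ω | ∀ i ≤ τ, U i ω = h i}, Urn.step T f (U τ ω) ∂P := by
  have hm : ∀ x, MeasurableSet {ω | (∀ i ≤ τ, U i ω = h i) ∧ U (τ + 1) ω = (h τ).addBall x} :=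
    fun x => (hU.filtration.le τ _ (hU.measurableSet_cylinder τ h)).inter (hU.measurableSet _ _)
  have hmc : MeasurableSet {ω | ∀ i ≤ τ, U i ω = h i} :=
    hU.filtration.le τ _ (hU.measurableSet_cylinder τ h)
  rw [← setIntegral_congr_set (hU.cylinder_ae_eq τ h),
    integral_iUnion_fintype hm (fun x y hxy => Set.disjoint_left.2 fun ω h1 h2 =>
    hxy ((h τ).addBall_injective (h1.2.symm.trans h2.2)))
    fun x => (hU.integrable f (τ + 1)).integrableOn,
    setIntegral_congr_fun (g := fun _ => Urn.step T f (h τ)) hmc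
      (fun ω hω => by simp only [hω τ le_rfl])]
  rw [setIntegral_const, smul_eq_mul, Urn.step, Finset.mul_sum]
  refine Finset.sum_congr rfl fun x _ => ?_
  rw [setIntegral_congr_fun (g := fun _ => f ((h τ).addBall x)) (hm x)
    (fun ω hω => by simp only [hω.2]), setIntegral_const, smul_eq_mul, measureReal_def, hU.step,
    ENNReal.toReal_mul, ENNReal.toReal_ofReal ((h τ).twoAlternativesProb_nonneg T x),
    measureReal_def, mul_assoc]

/-- The one-step evolution of expectations on events that are determined by the past. -/
theorem setIntegral_succ (hU : IsTwoAlternativesReinforcement T n₀ P U) (f : Urn X → ℝ) {τ : ℕ}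
    {C : Set Ω} (hC : MeasurableSet[hU.filtration τ] C) :
    ∫ ω in C, f (U (τ + 1) ω) ∂P = ∫ ω in C, Urn.step T f (U τ ω) ∂P := by
  obtain ⟨S, -, rfl⟩ := hC
  have e : urnHistory U τ ⁻¹' S = ⋃ h : S, urnHistory U τ ⁻¹' {(h : Fin (τ + 1) → Urn X)} := by
    ext ω
    simp
  have hm : ∀ h : S, MeasurableSet (urnHistory U τ ⁻¹' {(h : Fin (τ + 1) → Urn X)}) :=
    fun h => hU.filtration.le τ _ ⟨_, trivial, rfl⟩
  have hd : Pairwise (Function.onFun Disjoint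
      fun h : S => urnHistory U τ ⁻¹' {(h : Fin (τ + 1) → Urn X)}) := fun h h' hne =>
    Set.disjoint_left.2 fun ω h1 h2 => hne (Subtype.ext (h1.symm.trans h2))
  rw [e, integral_iUnion hm hd (hU.integrable f _).integrableOn,
    integral_iUnion hm hd (hU.integrable (Urn.step T f) _).integrableOn]
  refine tsum_congr fun h => ?_
  obtain ⟨h', hh'⟩ := exists_history_extension τ h.1
  have e2 : urnHistory U τ ⁻¹' {(h : Fin (τ + 1) → Urn X)} = {ω | ∀ i ≤ τ, U i ω = h' i} := by
    ext ω
    rw [hh']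
    exact urnHistory_eq_iff U τ ω h'
  rw [e2]
  exact hU.setIntegral_cylinder_succ f τ h'

theorem integral_succ (hU : IsTwoAlternativesReinforcement T n₀ P U) (f : Urn X → ℝ) (τ : ℕ) :
    ∫ ω, f (U (τ + 1) ω) ∂P = ∫ ω, Urn.step T f (U τ ω) ∂P := by
  have := hU.setIntegral_succ f (τ := τ) (C := Set.univ)
    (@MeasurableSet.univ _ (hU.filtration τ))
  simpa using this

end IsTwoAlternativesReinforcement

/-! ### Convergence tools for series and martingales -/

theorem MeasureTheory.ae_summable_of_sum_integral_le {Ω : Type*} [MeasurableSpace Ω]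
    {μ : Measure Ω} {f : ℕ → Ω → ℝ} {B : ℝ} (hf : ∀ i, Integrable (f i) μ)
    (h0 : ∀ i ω, 0 ≤ f i ω) (hB : ∀ n, ∑ i ∈ Finset.range n, ∫ ω, f i ω ∂μ ≤ B) :
    ∀ᵐ ω ∂μ, Summable fun i => f i ω := by
  have hs : Summable fun i => ∫ ω, f i ω ∂μ :=
    summable_of_sum_range_le (fun i => integral_nonneg (h0 i)) hB
  have h1 : ∫⁻ ω, ∑' i, ENNReal.ofReal (f i ω) ∂μ ≠ ⊤ := by
    rw [lintegral_tsum fun i => (hf i).aestronglyMeasurable.aemeasurable.ennreal_ofReal]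
    simp only [← ofReal_integral_eq_lintegral_ofReal (hf _) (ae_of_all _ (h0 _))]
    exact hs.tsum_ofReal_ne_top
  have h2 := ae_lt_top' (AEMeasurable.tsum
    fun i => (hf i).aestronglyMeasurable.aemeasurable.ennreal_ofReal) h1
  filter_upwards [h2] with ω hω
  refine (ENNReal.summable_toReal hω.ne).congr fun i => ?_
  rw [ENNReal.toReal_ofReal (h0 i ω)]

/-- Orthogonality of the increment to the past: conditioning on `ℱ s` turns the cross term into `f s
^ 2`. -/
theorem MeasureTheory.Martingale.integral_sq_succ {Ω : Type*} {m : MeasurableSpace Ω}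
    {μ : Measure Ω} [IsFiniteMeasure μ] {ℱ : Filtration ℕ m} {f : ℕ → Ω → ℝ}
    (hf : Martingale f ℱ μ) (h2 : ∀ i, MemLp (f i) 2 μ) (s : ℕ) :
    ∫ ω, f (s + 1) ω ^ 2 ∂μ = ∫ ω, f s ω ^ 2 ∂μ + ∫ ω, (f (s + 1) ω - f s ω) ^ 2 ∂μ := by
  have hm : Integrable (f s * f (s + 1)) μ := (h2 s).integrable_mul (h2 (s + 1))
  have hcross : ∫ ω, f s ω * f (s + 1) ω ∂μ = ∫ ω, f s ω ^ 2 ∂μ := by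
    have h3 : μ[f s * f (s + 1) | ℱ s] =ᵐ[μ] fun ω => f s ω ^ 2 := by
      have h4 := condExp_mul_of_stronglyMeasurable_left (hf.1 s) hm (hf.integrable (s + 1))
      filter_upwards [h4, hf.condExp_ae_eq (Nat.le_succ s)] with ω h5 h6
      rw [h5, Pi.mul_apply, h6, sq]
    rw [← integral_congr_ae h3, integral_condExp]
    rfl
  have e : ∀ ω, (f (s + 1) ω - f s ω) ^ 2
      = f (s + 1) ω ^ 2 - 2 * (f s ω * f (s + 1) ω) + f s ω ^ 2 := fun ω => by ring
  simp only [e]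
  have hm' : Integrable (fun ω => 2 * (f s ω * f (s + 1) ω)) μ := hm.const_mul 2
  have hd : Integrable (fun ω => f (s + 1) ω ^ 2 - 2 * (f s ω * f (s + 1) ω)) μ :=
    (h2 (s + 1)).integrable_sq.sub hm'
  rw [integral_add hd (h2 s).integrable_sq, integral_sub (h2 (s + 1)).integrable_sq hm',
    integral_const_mul, hcross]
  ring

/-- A martingale with bounded terms and square-summable increments converges almost surely. -/
theorem MeasureTheory.Martingale.ae_exists_tendsto_of_sq_summable {Ω : Type*}
    {m : MeasurableSpace Ω} {μ : Measure Ω} [IsProbabilityMeasure μ] {ℱ : Filtration ℕ m}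
    {f : ℕ → Ω → ℝ} (hf : Martingale f ℱ μ) (h2 : ∀ i, MemLp (f i) 2 μ) {b : ℕ → ℝ}
    (hb : Summable b) (hb0 : ∀ i, 0 ≤ b i)
    (h : ∀ i, ∀ᵐ ω ∂μ, (f (i + 1) ω - f i ω) ^ 2 ≤ b i) :
    ∀ᵐ ω ∂μ, ∃ c, Tendsto (fun i => f i ω) atTop (𝓝 c) := by
  have hsq : ∀ s, ∫ ω, f s ω ^ 2 ∂μ ≤ ∫ ω, f 0 ω ^ 2 ∂μ + ∑ i ∈ Finset.range s, b i := by
    intro s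
    induction s with
    | zero => simp
    | succ s ih =>
      rw [hf.integral_sq_succ h2, Finset.sum_range_succ]
      have : ∫ ω, (f (s + 1) ω - f s ω) ^ 2 ∂μ ≤ ∫ _ω, b s ∂μ :=
        integral_mono_ae ((h2 (s + 1)).sub (h2 s)).integrable_sq (integrable_const _) (h s)
      simp only [integral_const, probReal_univ, one_smul] at this
      linarith
  set R : ℝ := 1 + (∫ ω, f 0 ω ^ 2 ∂μ + ∑' i, b i) with hR
  refine hf.submartingale.exists_ae_tendsto_of_bdd (R := R.toNNReal) fun s => ?_
  rw [eLpNorm_one_eq_lintegral_enorm, ← ofReal_integral_norm_eq_lintegral_enorm (hf.integrable s)]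
  refine ENNReal.ofReal_le_ofReal ?_
  calc ∫ ω, ‖f s ω‖ ∂μ ≤ ∫ ω, (1 + f s ω ^ 2) ∂μ := by
        refine integral_mono (hf.integrable s).norm
          ((integrable_const _).add (h2 s).integrable_sq) fun ω => ?_
        simp only [Real.norm_eq_abs]
        nlinarith [sq_abs (f s ω), sq_nonneg (|f s ω| - 1)]
    _ = 1 + ∫ ω, f s ω ^ 2 ∂μ := by
        rw [integral_add (integrable_const _) (h2 s).integrable_sq]
        simp
    _ ≤ R := by
        have := hb.sum_le_tsum (Finset.range s) fun i _ => hb0 i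
        linarith [hsq s]

/-! ### Vanishing outside shares and rest points -/

namespace Urn

variable {X : Type*} [Fintype X] [Nonempty X] (T : Tournament X) (a : X) (n : Urn X)

/-- The expected increment of the share of the colour `a`. -/
noncomputable def drift {X : Type*} [Fintype X] (T : Tournament X) (a : X) (n : Urn X) : ℝ :=
  n.normalized a * T.payoffAgainst a n.normalized / (n.total + 1)

theorem step_normalized_eq_drift :
    step T (fun m => m.normalized a) n = n.normalized a + drift T a n :=
  n.step_normalized T a

theorem abs_drift_le : |drift T a n| ≤ 1 / n.total := by
  have hN := n.total_cast_pos
  have h1 := T.abs_payoffAgainst_le_one a n.normalized_mem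
  have h2 := n.normalized_le_one a
  have h3 := n.normalized_pos a
  rw [drift, abs_div, abs_mul, abs_of_pos h3, abs_of_pos (by linarith : (0 : ℝ) < n.total + 1)]
  refine div_le_div₀ zero_le_one ?_ hN (by linarith)
  exact mul_le_one₀ h2 (abs_nonneg _) h1

end Urn

namespace IsTwoAlternativesReinforcement

/-- The composition of the urn minus its accumulated expected increments. -/
noncomputable def compensated {X Ω : Type*} [Fintype X] (T : Tournament X)
    (U : ℕ → Ω → Urn X) (a : X) (τ : ℕ) (ω : Ω) : ℝ :=
  (U τ ω).normalized a - ∑ r ∈ Finset.range τ, Urn.drift T a (U r ω)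

theorem compensated_succ_sub {X Ω : Type*} [Fintype X] {T : Tournament X}
    {U : ℕ → Ω → Urn X} (a : X) (τ : ℕ) (ω : Ω) :
    compensated T U a (τ + 1) ω - compensated T U a τ ω
      = (U (τ + 1) ω).normalized a - (U τ ω).normalized a - Urn.drift T a (U τ ω) := by
  simp only [compensated, Finset.sum_range_succ]
  ring

variable {X : Type*} [Fintype X] {T : Tournament X} {n₀ : Urn X}
  {Ω : Type*} [MeasurableSpace Ω] {P : Measure Ω} {U : ℕ → Ω → Urn X}

theorem stronglyAdapted (hU : IsTwoAlternativesReinforcement T n₀ P U) (f : Urn X → ℝ) {s τ : ℕ}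
    (h : s ≤ τ) : StronglyMeasurable[hU.filtration τ] fun ω => f (U s ω) :=
  (measurable_urnFiltration hU.measurableSet h f).stronglyMeasurable

variable [IsProbabilityMeasure P]

theorem integral_zero (hU : IsTwoAlternativesReinforcement T n₀ P U) (f : Urn X → ℝ) :
    ∫ ω, f (U 0 ω) ∂P = f n₀ := by
  have h : (fun ω => f (U 0 ω)) =ᵐ[P] fun _ => f n₀ := by
    filter_upwards [hU.initial] with ω hω
    rw [hω]
  rw [integral_congr_ae h]
  simp

variable [Nonempty X]

/-- Telescoping of the exact drift of the gap. As the gap is nonnegative, the accumulated expected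
drift never exceeds the initial gap. -/
theorem integral_gap_le (hU : IsTwoAlternativesReinforcement T n₀ P U) (τ : ℕ) :
    ∫ ω, (U τ ω).gap T ∂P + ∑ r ∈ Finset.range τ, ∫ ω, T.expectedPayoff T.optimalStrategy
      (U r ω).normalized / (U r ω).total ∂P = n₀.gap T := by
  induction τ with
  | zero => simpa using hU.integral_zero (Urn.gap T)
  | succ τ ih =>
    rw [hU.integral_succ (Urn.gap T), Finset.sum_range_succ, ← ih]
    simp only [Urn.step_gap]
    rw [integral_sub (hU.integrable (Urn.gap T) τ) (hU.integrable (fun n => T.expectedPayoff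
      T.optimalStrategy n.normalized / n.total) τ)]
    ring

theorem supermartingale_gap (hU : IsTwoAlternativesReinforcement T n₀ P U) :
    Supermartingale (fun τ ω => (U τ ω).gap T) hU.filtration P := by
  refine supermartingale_of_setIntegral_succ_le (fun τ => hU.stronglyAdapted (Urn.gap T) le_rfl)
    (fun τ => hU.integrable (Urn.gap T) τ) fun τ C hC => ?_
  rw [hU.setIntegral_succ (Urn.gap T) hC]
  refine integral_mono (hU.integrable (Urn.step T (Urn.gap T)) τ).integrableOn
    (hU.integrable (Urn.gap T) τ).integrableOn fun ω => ?_
  simp only [Urn.step_gap]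
  have := div_nonneg ((U τ ω).expectedPayoff_normalized_nonneg T) (U τ ω).total_cast_pos.le
  linarith

theorem ae_bddAbove_gap (hU : IsTwoAlternativesReinforcement T n₀ P U) :
    ∀ᵐ ω ∂P, ∃ K, ∀ τ, (U τ ω).gap T ≤ K := by
  have h := hU.supermartingale_gap.neg.exists_ae_tendsto_of_bdd (R := (n₀.gap T).toNNReal)
    fun τ => ?_
  · filter_upwards [h] with ω ⟨c, hc⟩
    obtain ⟨K, hK⟩ := hc.neg.bddAbove_range
    exact ⟨K, fun τ => by simpa using hK ⟨τ, rfl⟩⟩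
  · rw [Pi.neg_apply, eLpNorm_neg, eLpNorm_one_eq_lintegral_enorm,
      ← ofReal_integral_norm_eq_lintegral_enorm (hU.integrable (Urn.gap T) τ)]
    refine ENNReal.ofReal_le_ofReal ?_
    have h1 := hU.integral_gap_le τ
    have h2 : 0 ≤ ∑ r ∈ Finset.range τ, ∫ ω, T.expectedPayoff T.optimalStrategy
      (U r ω).normalized / (U r ω).total ∂P := Finset.sum_nonneg fun r _ =>
        integral_nonneg fun ω => div_nonneg ((U r ω).expectedPayoff_normalized_nonneg T)
          (U r ω).total_cast_pos.le
    simp only [Real.norm_of_nonneg (Urn.gap_nonneg T _)]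
    linarith

/-- The share of `a`, divided by `N`, is dominated by the drift of the gap and is therefore almost
surely summable. Since shares move by at most `1 / N`, summability forces convergence to zero. -/
theorem ae_tendsto_zero (hU : IsTwoAlternativesReinforcement T n₀ P U) {a : X}
    (ha : T.optimalStrategy a = 0) :
    ∀ᵐ ω ∂P, Tendsto (fun τ => (U τ ω).normalized a) atTop (𝓝 0) := by
  obtain ⟨c, hc, -, hcle⟩ := T.exists_payoffAgainst_optimalStrategy_le_neg
  have hsum := ae_summable_of_sum_integral_le (μ := P)
    (f := fun τ ω => (U τ ω).normalized a / (U τ ω).total) (B := n₀.gap T / c)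
    (fun τ => hU.integrable (fun n => n.normalized a / n.total) τ)
    (fun τ ω => div_nonneg ((U τ ω).normalized_pos a).le (U τ ω).total_cast_pos.le) fun τ => by
      rw [le_div_iff₀' hc, Finset.mul_sum]
      have h1 := hU.integral_gap_le τ
      have h2 : 0 ≤ ∫ ω, (U τ ω).gap T ∂P := integral_nonneg fun ω => Urn.gap_nonneg T _
      refine le_trans (Finset.sum_le_sum fun r _ => ?_) (by linarith :
        ∑ r ∈ Finset.range τ, ∫ ω, T.expectedPayoff T.optimalStrategy
          (U r ω).normalized / (U r ω).total ∂P ≤ n₀.gap T)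
      rw [← integral_const_mul]
      refine integral_mono (hU.integrable (fun n => c * (n.normalized a / n.total)) r)
        (hU.integrable (fun n => T.expectedPayoff T.optimalStrategy n.normalized / n.total) r)
        fun ω => ?_
      simp only [← mul_div_assoc]
      refine div_le_div_of_nonneg_right ?_ (U r ω).total_cast_pos.le
      exact (mul_le_mul_of_nonneg_left ((U r ω).normalized_le_outsideShare T ha) hc.le).trans
        ((U r ω).mul_outsideShare_le_expectedPayoff T hcle)
  filter_upwards [hsum, hU.ae_total_eq, hU.ae_exists_eq_addBall] with ω h1 h2 h3
  have hcast : ∀ r, ((U r ω).total : ℝ) = r + n₀.total := by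
    intro r
    rw [h2]
    push_cast
    ring
  refine tendsto_zero_of_summable_div n₀.total_cast_pos
    (fun r => ((U r ω).normalized_pos a).le) (fun r => ?_) ?_
  · obtain ⟨x, hx⟩ := h3 r
    rw [hx, ← hcast]
    exact Urn.abs_normalized_addBall_sub_le _ _ _
  · simpa only [hcast] using h1

theorem martingale_compensated (hU : IsTwoAlternativesReinforcement T n₀ P U) (a : X) :
    Martingale (compensated T U a) hU.filtration P := by
  have hx := hU.integrable (fun n => n.normalized a)
  have hφ := hU.integrable (Urn.drift T a)
  have hi : ∀ τ, Integrable (fun ω => ∑ r ∈ Finset.range τ, Urn.drift T a (U r ω)) P :=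
    fun τ => integrable_finsetSum _ fun r _ => hφ r
  refine martingale_of_setIntegral_eq_succ (fun τ => ?_) (fun τ => (hx τ).sub (hi τ))
    fun τ C hC => ?_
  · refine (hU.stronglyAdapted (fun n => n.normalized a) le_rfl).sub ?_
    refine Finset.stronglyMeasurable_fun_sum _ fun r hr => ?_
    exact hU.stronglyAdapted (Urn.drift T a) (Finset.mem_range.1 hr).le
  · have h1 := hU.setIntegral_succ (fun n => n.normalized a) hC
    simp only [Urn.step_normalized_eq_drift] at h1
    rw [integral_add (hx τ).integrableOn (hφ τ).integrableOn] at h1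
    have h2 : IntegrableOn (fun ω => ∑ r ∈ Finset.range τ, Urn.drift T a (U r ω)
        + Urn.drift T a (U τ ω)) C P := ((hi τ).add (hφ τ)).integrableOn
    simp only [compensated, Finset.sum_range_succ]
    rw [integral_sub (hx τ).integrableOn (hi τ).integrableOn,
      integral_sub (hx (τ + 1)).integrableOn h2,
      integral_add (hi τ).integrableOn (hφ τ).integrableOn, h1]
    ring

theorem memLp_compensated (hU : IsTwoAlternativesReinforcement T n₀ P U) (a : X) (τ : ℕ) :
    MemLp (compensated T U a τ) 2 P := by
  have hle : ∀ ω, ‖compensated T U a τ ω‖ ≤ 1 + τ := by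
    intro ω
    have h1 : |(U τ ω).normalized a| ≤ 1 := by
      rw [abs_of_pos ((U τ ω).normalized_pos a)]
      exact (U τ ω).normalized_le_one a
    have h2 : |∑ r ∈ Finset.range τ, Urn.drift T a (U r ω)| ≤ τ := by
      refine (Finset.abs_sum_le_sum_abs _ _).trans ?_
      refine (Finset.sum_le_sum fun r _ => ?_).trans (by simp : ∑ r ∈ Finset.range τ, 1 ≤ (τ : ℝ))
      refine (Urn.abs_drift_le T a _).trans ?_
      rw [div_le_one (U r ω).total_cast_pos]
      exact_mod_cast (U r ω).total_pos
    exact (abs_sub _ _).trans (add_le_add h1 h2)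
  exact MemLp.of_bound ((hU.martingale_compensated a).integrable τ).aestronglyMeasurable _
    (ae_of_all _ hle)

theorem ae_sq_compensated_le (hU : IsTwoAlternativesReinforcement T n₀ P U) (a : X) (r : ℕ) :
    ∀ᵐ ω ∂P, (compensated T U a (r + 1) ω - compensated T U a r ω) ^ 2
      ≤ 4 * (1 / ((r + n₀.total : ℕ) : ℝ) ^ 2) := by
  filter_upwards [hU.ae_total_eq, hU.ae_exists_eq_addBall] with ω h1 h2
  obtain ⟨x, hx⟩ := h2 r
  have h3 := Urn.abs_normalized_addBall_sub_le (U r ω) x a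
  rw [← hx] at h3
  have h4 := Urn.abs_drift_le T a (U r ω)
  have h5 : |compensated T U a (r + 1) ω - compensated T U a r ω| ≤ 2 * (1 / (U r ω).total) := by
    rw [compensated_succ_sub]
    exact (abs_sub _ _).trans (by linarith)
  have h6 := pow_le_pow_left₀ (abs_nonneg _) h5 2
  rw [sq_abs, h1, add_comm n₀.total] at h6
  refine h6.trans (le_of_eq ?_)
  rw [mul_pow, div_pow, one_pow]
  norm_num

/-- Almost surely, every limit of the compositions is a rest point of the replicator dynamics. -/
theorem ae_rest_of_tendsto (hU : IsTwoAlternativesReinforcement T n₀ P U) (a : X) :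
    ∀ᵐ ω ∂P, ∀ p : X → ℝ, Tendsto (fun τ => (U τ ω).normalized) atTop (𝓝 p) →
      p a * T.payoffAgainst a p = 0 := by
  have hconv := (hU.martingale_compensated a).ae_exists_tendsto_of_sq_summable
    (hU.memLp_compensated a)
    (b := fun r => 4 * (1 / ((r + n₀.total : ℕ) : ℝ) ^ 2))
    (Summable.mul_left 4 ((summable_nat_add_iff (f := fun r : ℕ => 1 / (r : ℝ) ^ 2) n₀.total).2
      (Real.summable_one_div_nat_pow.2 one_lt_two)))
    (fun r => by positivity) (hU.ae_sq_compensated_le a)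
  filter_upwards [hconv, hU.ae_total_eq] with ω ⟨d, hd⟩ h1 p hp
  have hpa : Tendsto (fun τ => (U τ ω).normalized a) atTop (𝓝 (p a)) := (tendsto_pi_nhds.1 hp) a
  -- The accumulated drift is the share minus the convergent compensated share, so it converges to
  -- `p a - d`. The drift at time `r` has denominator `r + n₀.total + 1`.
  refine eq_zero_of_tendsto_sum_div (c := n₀.total + 1) (S := p a - d)
    (by linarith [n₀.total_cast_pos])
    (hpa.mul (((T.continuous_payoffAgainst a).tendsto p).comp hp)) ?_
  refine (hpa.sub hd).congr fun τ => ?_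
  simp only [compensated, sub_sub_cancel]
  refine Finset.sum_congr rfl fun r _ => ?_
  simp only [Urn.drift, h1, Function.comp]
  push_cast
  congr 1
  ring

end IsTwoAlternativesReinforcement

/-! ### Quadratic functions of the gap and a maximal inequality -/

theorem Tournament.expectedPayoff_optimalStrategy_eq_zero {X : Type*} [Fintype X] [Nonempty X]
    (T : Tournament X) (hT : ∀ a, T.optimalStrategy a ≠ 0) (q : X → ℝ) :
    T.expectedPayoff T.optimalStrategy q = 0 := by
  rw [T.expectedPayoff_eq_neg_sum]
  simp [T.payoffAgainst_optimalStrategy_of_ne_zero (hT _)]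

namespace Urn

variable {X : Type*} [Fintype X] (T : Tournament X) (n : Urn X)

theorem step_add (f g : Urn X → ℝ) :
    step T (fun m => f m + g m) n = step T f n + step T g n := by
  simp [step, mul_add, Finset.sum_add_distrib]

theorem step_const_mul (c : ℝ) (f : Urn X → ℝ) :
    step T (fun m => c * f m) n = c * step T f n := by
  simp only [step, Finset.mul_sum]
  exact Finset.sum_congr rfl fun x _ => by ring

theorem step_div_total (f : Urn X → ℝ) :
    step T (fun m => f m / m.total) n = step T f n / (n.total + 1) := by
  simp only [step, Finset.sum_div, total_addBall]
  exact Finset.sum_congr rfl fun x _ => by push_cast; ring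

variable [Nonempty X]

theorem step_const (c : ℝ) : step T (fun _ => c) n = c := by
  rw [step, ← Finset.sum_mul, n.sum_twoAlternativesProb T, one_mul]

theorem inv_total_sub_ge : 1 / (n.total : ℝ) ^ 2 ≤ 2 * (1 / n.total - 1 / (n.total + 1)) := by
  have hN : (1 : ℝ) ≤ n.total := by exact_mod_cast n.total_pos
  have e : 2 * (1 / (n.total : ℝ) - 1 / (n.total + 1)) = 2 / (n.total * (n.total + 1)) := by
    field_simp
    ring
  rw [e, div_le_div_iff₀ (by positivity) (by positivity)]
  nlinarith

/-- If the optimal strategy has full support, a quadratic function of the gap, with a correction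
for the variance of its future increments, is superharmonic near the optimal strategy. -/
theorem step_sq_gap_add_le (hT : ∀ a, T.optimalStrategy a ≠ 0) {c : ℝ} (hc : 0 < c)
    (hp : ∀ a, c ≤ T.optimalStrategy a) (b : ℝ) (h : 16 * n.gap T ≤ c ^ 2) :
    step T (fun m => (m.gap T - b) ^ 2 + 32 / c ^ 2 * (m.gap T / m.total)) n
      ≤ (n.gap T - b) ^ 2 + 32 / c ^ 2 * (n.gap T / n.total) := by
  have hN := n.total_cast_pos
  have hg := n.gap_nonneg T
  have h1 := n.step_sq_gap_sub_le_mul_gap T hc hp h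
  rw [step_add, step_sq_sub_const, step_const_mul, step_div_total, step_gap,
    T.expectedPayoff_optimalStrategy_eq_zero hT]
  -- The gap has no drift here, so the expected correction falls only through `1 / N` becoming `1 /
  -- (N + 1)`. The coefficient `32 / c ^ 2` is twice that of the variance, which makes this fall pay
  -- for it.
  have h2 := mul_le_mul_of_nonneg_left n.inv_total_sub_ge
    (by positivity : 0 ≤ 16 / c ^ 2 * n.gap T)
  have e1 : 16 / c ^ 2 * n.gap T * (1 / (n.total : ℝ) ^ 2)
      = 16 / c ^ 2 * n.gap T / (n.total : ℝ) ^ 2 := by ring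
  have e2 : 16 / c ^ 2 * n.gap T * (2 * (1 / (n.total : ℝ) - 1 / (n.total + 1)))
      = 32 / c ^ 2 * (n.gap T / n.total) - 32 / c ^ 2 * (n.gap T / (n.total + 1)) := by ring
  rw [e1, e2] at h2
  simp only [zero_div, sub_zero, sub_self, mul_zero, add_zero]
  linarith

/-- A quadratic function of the gap, with corrections for its future expected increments and their
variance, is superharmonic where the gap is close to `δ`. -/
theorem step_sq_gap_sub_add_le {c d δ : ℝ} (hc : 0 < c) (hd : 0 < d)
    (hp : ∀ a, T.optimalStrategy a ≠ 0 → c ≤ T.optimalStrategy a)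
    (hδ : |n.gap T - δ| ≤ δ / 2) (h : 16 * n.gap T ≤ c ^ 2)
    (hout : ∀ a, T.optimalStrategy a = 0 → T.payoffAgainst a n.normalized ≤ -d) :
    step T (fun m => (m.gap T - δ) ^ 2 + (2 * δ / d * m.outsideShare T + 2 * (1 / m.total))) n
      ≤ (n.gap T - δ) ^ 2 + (2 * δ / d * n.outsideShare T + 2 * (1 / n.total)) := by
  have hN : (1 : ℝ) ≤ n.total := by exact_mod_cast n.total_pos
  have hδ0 : 0 ≤ δ := by linarith [(abs_nonneg _).trans hδ]
  have h1 := n.step_sq_gap_sub_le T hc hp h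
  have h2 := n.step_outsideShare_le T hout
  have h3 := n.expectedPayoff_le_outsideShare T
  have h4 := n.expectedPayoff_normalized_nonneg T
  have h5 := n.outsideShare_nonneg T
  have h6 := n.inv_total_sub_ge
  rw [step_add, step_add, step_sq_sub_const, step_const_mul, step_const_mul, step_div_total,
    step_const, step_gap]
  -- In the band `2 |gap - δ| ≤ δ`, so the drift costs at most `δ / N` times the outside share. The
  -- correction `2 δ / d` times that share falls by `2 δ / (N + 1)` times the share, which suffices
  -- as `N + 1 ≤ 2 N`. The term `2 / N` pays for the variance `1 / N ^ 2`.
  have h7 : 2 * (n.gap T - δ) * (n.gap T - T.expectedPayoff T.optimalStrategy n.normalized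
      / n.total - n.gap T) ≤ δ * (n.outsideShare T / n.total) := by
    have e : 2 * (n.gap T - δ) * (n.gap T - T.expectedPayoff T.optimalStrategy n.normalized
      / n.total - n.gap T) = (-(2 * (n.gap T - δ)))
        * (T.expectedPayoff T.optimalStrategy n.normalized / n.total) := by ring
    rw [e]
    have hb := (abs_le.1 hδ).1
    refine mul_le_mul (by linarith) (div_le_div_of_nonneg_right h3 (by linarith))
      (div_nonneg h4 (by linarith)) hδ0
  have h8 : n.outsideShare T / n.total ≤ 2 * (n.outsideShare T / (n.total + 1)) := by
    rw [← mul_div_assoc, div_le_div_iff₀ (by linarith) (by linarith)]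
    nlinarith
  have h9 := mul_le_mul_of_nonneg_left h8 hδ0
  have h10 := mul_le_mul_of_nonneg_left h2 (by positivity : 0 ≤ 2 * δ / d)
  have e3 : 2 * δ / d * (n.outsideShare T - d * n.outsideShare T / (n.total + 1))
      = 2 * δ / d * n.outsideShare T - 2 * δ * (n.outsideShare T / (n.total + 1)) := by
    field_simp
  rw [e3] at h10
  linarith

end Urn

namespace IsTwoAlternativesReinforcement

variable {X : Type*} [Fintype X] {T : Tournament X} {n₀ : Urn X}
  {Ω : Type*} [MeasurableSpace Ω] {P : Measure Ω} {U : ℕ → Ω → Urn X}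

theorem measurableSet_forall_mem (hU : IsTwoAlternativesReinforcement T n₀ P U) (G : Set (Urn X))
    (τ : ℕ) : MeasurableSet[hU.filtration τ] {ω | ∀ i ≤ τ, U i ω ∈ G} :=
  ⟨{h | ∀ i, h i ∈ G}, trivial, by
    ext ω
    exact ⟨fun H i hi => H ⟨i, Nat.lt_succ_of_le hi⟩, fun H i => H i (Nat.le_of_lt_succ i.2)⟩⟩

variable [Nonempty X] [IsProbabilityMeasure P]

/-- A maximal inequality for a nonnegative function that is superharmonic on `G`. -/
theorem setIntegral_forall_mem_le (hU : IsTwoAlternativesReinforcement T n₀ P U) {G : Set (Urn X)}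
    {f : Urn X → ℝ} {κ : ℝ} (hstep : ∀ n ∈ G, Urn.step T f n ≤ f n)
    (hκ : ∀ n ∉ G, κ ≤ f n) (τ : ℕ) :
    ∫ ω in {ω | ∀ i ≤ τ, U i ω ∈ G}, f (U τ ω) ∂P
      + κ * (1 - P.real {ω | ∀ i ≤ τ, U i ω ∈ G}) ≤ f n₀ := by
  have hm : ∀ τ, MeasurableSet {ω | ∀ i ≤ τ, U i ω ∈ G} :=
    fun τ => hU.filtration.le τ _ (hU.measurableSet_forall_mem G τ)
  induction τ with
  | zero =>
    by_cases h0 : n₀ ∈ G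
    · have e : {ω | ∀ i ≤ 0, U i ω ∈ G} =ᵐ[P] Set.univ := by
        rw [ae_eq_univ_iff_measure_eq (hm 0).nullMeasurableSet, measure_univ]
        refine (prob_compl_eq_zero_iff (hm 0)).1 ?_
        refine measure_mono_null (fun ω hω => ?_) (ae_iff.1 hU.initial)
        intro h
        refine hω fun i hi => ?_
        rw [Nat.le_zero.1 hi, h]
        exact h0
      rw [setIntegral_congr_set e, measureReal_congr e, setIntegral_univ, hU.integral_zero f]
      simp
    · have e : {ω | ∀ i ≤ 0, U i ω ∈ G} =ᵐ[P] (∅ : Set Ω) := by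
        rw [ae_eq_empty]
        refine measure_mono_null (fun ω hω => ?_) (ae_iff.1 hU.initial)
        intro h
        exact h0 (h ▸ hω 0 le_rfl)
      rw [setIntegral_congr_set e, measureReal_congr e]
      simpa using hκ n₀ h0
  | succ τ ih =>
    refine le_trans ?_ ih
    have hsub : {ω | ∀ i ≤ τ + 1, U i ω ∈ G} ⊆ {ω | ∀ i ≤ τ, U i ω ∈ G} :=
      fun ω h i hi => h i (hi.trans (Nat.le_succ τ))
    have hint := hU.integrable f
    have h1 : ∫ ω in {ω | ∀ i ≤ τ, U i ω ∈ G}, f (U (τ + 1) ω) ∂P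
        ≤ ∫ ω in {ω | ∀ i ≤ τ, U i ω ∈ G}, f (U τ ω) ∂P := by
      rw [hU.setIntegral_succ f (hU.measurableSet_forall_mem G τ)]
      exact setIntegral_mono_on (hU.integrable (Urn.step T f) τ).integrableOn
        (hint τ).integrableOn (hm τ) fun ω hω => hstep _ (hω τ le_rfl)
    have h2 := setIntegral_sdiff (μ := P) (hm (τ + 1)) (hint (τ + 1)).integrableOn hsub
    -- Paths that first leave `G` at time `τ + 1` have `f ≥ κ` there, and their mass is added to the
    -- exit probability.
    have h3 : κ * (P.real {ω | ∀ i ≤ τ, U i ω ∈ G} - P.real {ω | ∀ i ≤ τ + 1, U i ω ∈ G})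
        ≤ ∫ ω in {ω | ∀ i ≤ τ, U i ω ∈ G} \ {ω | ∀ i ≤ τ + 1, U i ω ∈ G}, f (U (τ + 1) ω) ∂P := by
      rw [← measureReal_sdiff hsub (hm _), mul_comm, ← smul_eq_mul, ← setIntegral_const]
      refine setIntegral_mono_on (integrable_const _) (hint _).integrableOn
        ((hm τ).diff (hm (τ + 1))) fun ω hω => hκ _ fun hG => hω.2 fun i hi => ?_
      rcases Nat.le_succ_iff.1 hi with h | h
      · exact hω.1 i h
      · rw [h]
        exact hG
    linarith

end IsTwoAlternativesReinforcement

/-! ### Full support: no convergence to the optimal strategy -/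

namespace IsTwoAlternativesReinforcement

variable {X : Type*} [Fintype X] [Nonempty X] {T : Tournament X} {n₀ : Urn X}
  {Ω : Type*} [MeasurableSpace Ω] {P : Measure Ω} {U : ℕ → Ω → Urn X}

theorem measurableSet_gap_tendsto (hU : IsTwoAlternativesReinforcement T n₀ P U) (c : ℝ) (s : ℕ) :
    MeasurableSet[⨆ τ, hU.filtration τ] {ω | (∀ τ, 16 * (U (s + τ) ω).gap T ≤ c ^ 2) ∧
      Tendsto (fun τ => (U (s + τ) ω).gap T) atTop (𝓝 0)} := by
  have hm : ∀ τ, Measurable[⨆ τ, hU.filtration τ] fun ω => (U (s + τ) ω).gap T := fun τ =>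
    (measurable_urnFiltration hU.measurableSet (le_refl (s + τ)) (Urn.gap T)).mono
      (le_iSup (fun τ => (hU.filtration τ : MeasurableSpace Ω)) (s + τ)) le_rfl
  let _ : MeasurableSpace Ω := ⨆ τ, hU.filtration τ
  refine MeasurableSet.inter ?_ (measurableSet_tendsto (𝓝 0) hm)
  have e : {ω | ∀ τ, 16 * (U (s + τ) ω).gap T ≤ c ^ 2}
      = ⋂ τ, {ω | 16 * (U (s + τ) ω).gap T ≤ c ^ 2} := by
    ext ω
    simp
  change MeasurableSet {ω | ∀ τ, 16 * (U (s + τ) ω).gap T ≤ c ^ 2}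
  rw [e]
  exact MeasurableSet.iInter fun τ => measurableSet_le ((hm τ).const_mul 16) measurable_const

theorem measurableSet_gap_tendsto' (hU : IsTwoAlternativesReinforcement T n₀ P U) (c : ℝ)
    (s : ℕ) : MeasurableSet {ω | (∀ τ, 16 * (U (s + τ) ω).gap T ≤ c ^ 2) ∧
      Tendsto (fun τ => (U (s + τ) ω).gap T) atTop (𝓝 0)} :=
  iSup_le (fun τ => hU.filtration.le τ) _ (hU.measurableSet_gap_tendsto c s)

variable [IsProbabilityMeasure P]

/-- If the optimal strategy has full support, then from every initial urn the composition converges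
to the optimal strategy inside a fixed neighbourhood with probability bounded away from one. -/
theorem measureReal_gap_tendsto_le (hU : IsTwoAlternativesReinforcement T n₀ P U)
    {a b : X} (hab : a ≠ b) {c : ℝ} (hc : 0 < c) (hp : ∀ a, c ≤ T.optimalStrategy a) :
    P.real {ω | (∀ τ, 16 * (U τ ω).gap T ≤ c ^ 2) ∧
      Tendsto (fun τ => (U τ ω).gap T) atTop (𝓝 0)} ≤ 1 - 1 / (1 + 384 / c ^ 4) := by
  set B := {ω | (∀ τ, 16 * (U τ ω).gap T ≤ c ^ 2) ∧
      Tendsto (fun τ => (U τ ω).gap T) atTop (𝓝 0)} with hB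
  have hBm : MeasurableSet B := by simpa only [zero_add] using hU.measurableSet_gap_tendsto' c 0
  -- Here `384 = 32 * 12`: the variance correction has coefficient `32 / c ^ 2`, and `1 / N ≤ 12 g /
  -- c ^ 2` for the initial gap `g`. Thus the correction is at most `(K - 1) g ^ 2`, and centring at
  -- `K g` makes the starting value at most `((K - 1) ^ 2 + (K - 1)) g ^ 2 = K (K - 1) g ^ 2`.
  set K := 1 + 384 / c ^ 4 with hK
  have hK1 : 1 < K := by
    have : 0 < 384 / c ^ 4 := by positivity
    linarith
  by_cases h0 : 16 * n₀.gap T ≤ c ^ 2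
  swap
  · have : P B = 0 := by
      refine measure_mono_null (fun ω hω => ?_) (ae_iff.1 hU.initial)
      intro h
      exact h0 (h ▸ hω.1 0)
    rw [measureReal_def, this, ENNReal.toReal_zero, sub_nonneg, div_le_one (by linarith)]
    exact hK1.le
  have hT : ∀ a, T.optimalStrategy a ≠ 0 := fun a => (hc.trans_le (hp a)).ne'
  set g := n₀.gap T with hg
  have hN := n₀.total_cast_pos
  have hgN : c ^ 2 / (12 * n₀.total) ≤ g := by
    refine le_trans ?_ (n₀.div_total_le_gap T hab)
    have h1 := n₀.half_le_normalized T hc h0 (hp b)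
    rw [div_le_div_iff₀ (by positivity) (by positivity)]
    have h2 : c * (c / 2) ≤ T.optimalStrategy a * n₀.normalized b :=
      mul_le_mul (hp a) h1 (by positivity) (T.optimalStrategy_nonneg a)
    nlinarith
  have hg0 : 0 < g := lt_of_lt_of_le (by positivity) hgN
  have hstart : (g - K * g) ^ 2 + 32 / c ^ 2 * (g / n₀.total) ≤ K * (K - 1) * g ^ 2 := by
    have h1 : g / n₀.total ≤ 12 / c ^ 2 * g ^ 2 := by
      rw [div_le_iff₀ (by positivity)] at hgN
      rw [div_le_iff₀ hN]
      have e : 12 / c ^ 2 * g ^ 2 * n₀.total = g * (g * (12 * n₀.total)) / c ^ 2 := by ring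
      rw [e, le_div_iff₀ (by positivity)]
      exact mul_le_mul_of_nonneg_left hgN hg0.le
    have h2 := mul_le_mul_of_nonneg_left h1 (by positivity : 0 ≤ 32 / c ^ 2)
    have h3 : 32 / c ^ 2 * (12 / c ^ 2 * g ^ 2) = (K - 1) * g ^ 2 := by
      rw [hK]
      field_simp
      ring
    nlinarith
  let f : Urn X → ℝ := fun m => (m.gap T - K * g) ^ 2 + 32 / c ^ 2 * (m.gap T / m.total)
  have hf0 : ∀ m, (m.gap T - K * g) ^ 2 ≤ f m := fun m => by
    have := div_nonneg (m.gap_nonneg T) m.total_cast_pos.le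
    have : 0 ≤ 32 / c ^ 2 * (m.gap T / m.total) := by positivity
    simp only [f]
    linarith
  have hle : ∀ τ, ∫ ω in B, ((U τ ω).gap T - K * g) ^ 2 ∂P ≤ K * (K - 1) * g ^ 2 := by
    intro τ
    -- With `κ = 0` the paths that leave the neighbourhood are simply discarded.
    have h1 := hU.setIntegral_forall_mem_le (G := {m | 16 * m.gap T ≤ c ^ 2}) (f := f) (κ := 0)
      (fun m hm => m.step_sq_gap_add_le T hT hc hp _ hm)
      (fun m _ => (sq_nonneg _).trans (hf0 m)) τ
    have h2 : ∫ ω in B, ((U τ ω).gap T - K * g) ^ 2 ∂P ≤ ∫ ω in B, f (U τ ω) ∂P :=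
      integral_mono (hU.integrable (fun m => (m.gap T - K * g) ^ 2) τ).integrableOn
        (hU.integrable f τ).integrableOn fun ω => hf0 _
    have h3 : ∫ ω in B, f (U τ ω) ∂P
        ≤ ∫ ω in {ω | ∀ i ≤ τ, U i ω ∈ {m : Urn X | 16 * m.gap T ≤ c ^ 2}}, f (U τ ω) ∂P :=
      setIntegral_mono_set (hU.integrable f τ).integrableOn
        (ae_of_all _ fun ω => (sq_nonneg _).trans (hf0 _))
        (Eventually.of_forall fun ω hω i _ => hω.1 i)
    rw [zero_mul, add_zero] at h1
    exact h2.trans (h3.trans (h1.trans hstart))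
  have hlim : Tendsto (fun τ => ∫ ω in B, ((U τ ω).gap T - K * g) ^ 2 ∂P) atTop
      (𝓝 (∫ _ω in B, (0 - K * g) ^ 2 ∂P)) := by
    refine tendsto_integral_of_dominated_convergence (fun _ => (c ^ 2 + K * g) ^ 2)
      (fun τ => (hU.integrable (fun m => (m.gap T - K * g) ^ 2) τ).aestronglyMeasurable.restrict)
      (integrable_const _) (fun τ => ?_) ?_
    · filter_upwards [ae_restrict_mem hBm] with ω hω
      have h1 := hω.1 τ
      have h2 := (U τ ω).gap_nonneg T
      have h3 : 0 < K * g := by positivity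
      rw [Real.norm_of_nonneg (sq_nonneg _)]
      exact sq_le_sq' (by nlinarith) (by nlinarith)
    · filter_upwards [ae_restrict_mem hBm] with ω hω
      exact (hω.2.sub_const _).pow 2
  have hfin := le_of_tendsto' hlim hle
  rw [setIntegral_const, smul_eq_mul] at hfin
  -- On `B` the gap tends to zero, so the limiting integrand is `K ^ 2 g ^ 2`. The bound on the
  -- starting value then gives `P(B) ≤ (K - 1) / K`, independently of the initial urn.
  have h1 : P.real B * K ^ 2 ≤ K * (K - 1) := by
    have : 0 < g ^ 2 := by positivity
    refine le_of_mul_le_mul_right ?_ this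
    linarith
  have h2 : P.real B * K ≤ K - 1 := by nlinarith
  have h3 : 1 - 1 / K = (K - 1) / K := by field_simp
  rw [h3, le_div_iff₀ (by linarith)]
  exact h2

/-- The bound is uniform in the initial urn, so by the Markov property it holds after every history
up to time `s`; summing over histories gives it on every event of the past. -/
theorem measure_gap_tendsto_inter_le (hU : IsTwoAlternativesReinforcement T n₀ P U)
    {a b : X} (hab : a ≠ b) {c : ℝ} (hc : 0 < c) (hp : ∀ a, c ≤ T.optimalStrategy a) (s : ℕ)
    {C : Set Ω} (hC : MeasurableSet[hU.filtration s] C) :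
    P (C ∩ {ω | (∀ τ, 16 * (U (s + τ) ω).gap T ≤ c ^ 2) ∧
      Tendsto (fun τ => (U (s + τ) ω).gap T) atTop (𝓝 0)})
      ≤ ENNReal.ofReal (1 - 1 / (1 + 384 / c ^ 4)) * P C := by
  set B := {ω | (∀ τ, 16 * (U (s + τ) ω).gap T ≤ c ^ 2) ∧
      Tendsto (fun τ => (U (s + τ) ω).gap T) atTop (𝓝 0)}
  have hBm : MeasurableSet B := hU.measurableSet_gap_tendsto' c s
  have hcyl : ∀ h : Fin (s + 1) → Urn X, P (urnHistory U s ⁻¹' {h} ∩ B)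
      ≤ ENNReal.ofReal (1 - 1 / (1 + 384 / c ^ 4)) * P (urnHistory U s ⁻¹' {h}) := by
    intro h
    obtain ⟨h', hh'⟩ := exists_history_extension s h
    have e2 : urnHistory U s ⁻¹' {h} = {ω | ∀ i ≤ s, U i ω = h' i} := by
      ext ω
      rw [hh']
      exact urnHistory_eq_iff U s ω h'
    rw [e2]
    have hm : MeasurableSet {ω | ∀ i ≤ s, U i ω = h' i} :=
      hU.filtration.le s _ (hU.measurableSet_cylinder s h')
    by_cases h0 : P {ω | ∀ i ≤ s, U i ω = h' i} = 0
    · rw [h0, mul_zero]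
      exact (measure_mono Set.inter_subset_left).trans h0.le
    · have : IsProbabilityMeasure (P[|{ω | ∀ i ≤ s, U i ω = h' i}]) :=
        cond_isProbabilityMeasure h0
      have h1 := (hU.cond_cylinder s h').measureReal_gap_tendsto_le hab hc hp
      rw [← cond_mul_eq_inter hm, mul_comm, mul_comm (ENNReal.ofReal _)]
      gcongr
      rw [← ofReal_measureReal]
      exact ENNReal.ofReal_le_ofReal h1
  obtain ⟨S, -, rfl⟩ := hC
  have e : urnHistory U s ⁻¹' S = ⋃ h : S, urnHistory U s ⁻¹' {(h : Fin (s + 1) → Urn X)} := by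
    ext ω
    simp
  have hm : ∀ h : S, MeasurableSet (urnHistory U s ⁻¹' {(h : Fin (s + 1) → Urn X)}) :=
    fun h => hU.filtration.le s _ ⟨_, trivial, rfl⟩
  have hd : Pairwise (Function.onFun Disjoint
      fun h : S => urnHistory U s ⁻¹' {(h : Fin (s + 1) → Urn X)}) := fun h h' hne =>
    Set.disjoint_left.2 fun ω h1 h2 => hne (Subtype.ext (h1.symm.trans h2))
  rw [e, Set.iUnion_inter, measure_iUnion hd hm, ← ENNReal.tsum_mul_left]
  exact (measure_iUnion_le _).trans (ENNReal.tsum_le_tsum fun h => hcyl h)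

/-- By Lévy's theorem the conditional probability of the event given the past converges to its
indicator. It stays below `ρ < 1` at all times `t ≥ s`, because the event only grows when `s` is
replaced by `t`. -/
theorem measure_gap_tendsto_eq_zero (hU : IsTwoAlternativesReinforcement T n₀ P U)
    {a b : X} (hab : a ≠ b) {c : ℝ} (hc : 0 < c) (hp : ∀ a, c ≤ T.optimalStrategy a) (s : ℕ) :
    P {ω | (∀ τ, 16 * (U (s + τ) ω).gap T ≤ c ^ 2) ∧
      Tendsto (fun τ => (U (s + τ) ω).gap T) atTop (𝓝 0)} = 0 := by
  let B : ℕ → Set Ω := fun s => {ω | (∀ τ, 16 * (U (s + τ) ω).gap T ≤ c ^ 2) ∧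
      Tendsto (fun τ => (U (s + τ) ω).gap T) atTop (𝓝 0)}
  have hB : ∀ s, MeasurableSet (B s) := fun s => hU.measurableSet_gap_tendsto' c s
  have hmono : ∀ t, s ≤ t → B s ⊆ B t := by
    intro t hst ω hω
    obtain ⟨k, rfl⟩ := Nat.exists_eq_add_of_le hst
    refine ⟨fun τ => ?_, ?_⟩
    · rw [add_assoc]
      exact hω.1 _
    · simp only [add_assoc]
      exact hω.2.comp (tendsto_atTop_mono (fun τ => Nat.le_add_left τ k) tendsto_id)
  set ρ := 1 - 1 / (1 + 384 / c ^ 4) with hρ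
  have hK : 0 < 384 / c ^ 4 := by positivity
  have hρ0 : 0 ≤ ρ := by
    rw [hρ, sub_nonneg, div_le_one (by linarith)]
    linarith
  have hρ1 : ρ < 1 := by
    have : 0 < 1 / (1 + 384 / c ^ 4) := by positivity
    linarith
  let ind : Ω → ℝ := (B s).indicator 1
  have hind : Integrable ind P := (integrable_const (1 : ℝ)).indicator (hB s)
  have hce : ∀ t, s ≤ t → P[ind | hU.filtration t] ≤ᵐ[P] fun _ => ρ := by
    intro t hst
    have hm := hU.filtration.le t
    refine ae_le_of_ae_le_trim (hm := hm) ?_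
    refine ae_le_of_forall_setIntegral_le
      (integrable_condExp.trim hm stronglyMeasurable_condExp)
      (integrable_const ρ) fun C hC _ => ?_
    rw [← setIntegral_trim hm stronglyMeasurable_condExp hC,
      ← setIntegral_trim hm stronglyMeasurable_const hC, setIntegral_condExp hm hind hC,
      setIntegral_indicator (hB s)]
    have h1 := hU.measure_gap_tendsto_inter_le hab hc hp t hC
    have h2 : P.real (C ∩ B s) ≤ ρ * P.real C := by
      have h3 := (measure_mono (Set.inter_subset_inter_right C (hmono t hst))).trans h1
      have h4 := ENNReal.toReal_mono (ENNReal.mul_ne_top ENNReal.ofReal_ne_top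
        (measure_ne_top P C)) h3
      rwa [ENNReal.toReal_mul, ENNReal.toReal_ofReal hρ0] at h4
    simp only [Pi.one_apply, setIntegral_const, smul_eq_mul, mul_one]
    linarith
  have hce' : ∀ᵐ ω ∂P, ∀ t, s ≤ t → (P[ind | hU.filtration t]) ω ≤ ρ := by
    rw [ae_all_iff]
    intro t
    by_cases hst : s ≤ t
    · filter_upwards [hce t hst] with ω hω _
      exact hω
    · exact ae_of_all _ fun ω h => absurd h hst
  have hlevy := tendsto_ae_condExp (μ := P) (ℱ := hU.filtration) ind
  have hsm : StronglyMeasurable[⨆ τ, hU.filtration τ] ind :=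
    (@stronglyMeasurable_const _ _ (⨆ τ, hU.filtration τ) _ (1 : ℝ)).indicator
      (hU.measurableSet_gap_tendsto c s)
  rw [condExp_of_stronglyMeasurable (iSup_le fun τ => hU.filtration.le τ) hsm hind] at hlevy
  refine measure_mono_null (fun ω hω => ?_) (ae_iff.1 (hlevy.and hce'))
  rintro ⟨h1, h2⟩
  have h3 := le_of_tendsto h1 (eventually_atTop.2 ⟨s, fun t ht => h2 t ht⟩)
  have h4 : ind ω = 1 := Set.indicator_of_mem hω _
  linarith

end IsTwoAlternativesReinforcement

/-! ### Urns with a prescribed approximate composition -/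

namespace Urn

variable {X : Type*} [Fintype X]

/-- The urn `n` with `v x` balls of each colour `x` added. -/
def addBalls (n : Urn X) (v : X → ℕ) : Urn X :=
  fun x => ⟨n x + v x, Nat.add_pos_left (n x).pos _⟩

theorem addBalls_induction {C : Urn X → Prop} {n : Urn X} (h0 : C n)
    (hadd : ∀ m x, C m → C (m.addBall x)) (v : X → ℕ) : C (n.addBalls v) := by
  classical
  induction hk : ∑ x, v x generalizing v with
  | zero =>
    have : n.addBalls v = n := by
      refine funext fun x => PNat.eq ?_
      have := (Finset.sum_eq_zero_iff.1 hk) x (Finset.mem_univ x)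
      simp [addBalls, this]
    rwa [this]
  | succ k ih =>
    obtain ⟨x, -, hx⟩ : ∃ x ∈ Finset.univ, v x ≠ 0 := by
      apply Finset.exists_ne_zero_of_sum_ne_zero
      omega
    have e : n.addBalls v = (n.addBalls (Function.update v x (v x - 1))).addBall x := by
      refine funext fun y => PNat.eq ?_
      by_cases hy : y = x
      · subst hy
        rw [addBall_self, PNat.add_coe]
        simp only [addBalls, PNat.mk_coe, Function.update_self, PNat.one_coe]
        omega
      · rw [addBall_of_ne _ hy]
        simp [addBalls, hy]
    rw [e]
    refine hadd _ _ (ih _ ?_)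
    have h1 := Finset.sum_update_of_mem (Finset.mem_univ x) v (v x - 1)
    have h2 := Finset.sum_update_of_mem (Finset.mem_univ x) v (v x)
    rw [Function.update_eq_self] at h2
    omega

/-- Every composition can be approximated by adding balls to a given urn. -/
theorem exists_addBalls_tendsto (n : Urn X) {q : X → ℝ} (hq : q ∈ stdSimplex ℝ X) :
    ∃ v : ℕ → X → ℕ, Tendsto (fun k => (n.addBalls (v k)).total) atTop atTop ∧
      Tendsto (fun k => (n.addBalls (v k)).normalized) atTop (𝓝 q) := by
  let v : ℕ → X → ℕ := fun k x => ⌈q x * k⌉₊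
  have h1 : ∀ x, Tendsto (fun k : ℕ => ((n.addBalls (v k) x : ℕ) : ℝ) / k) atTop (𝓝 (q x)) := by
    intro x
    have h2 := (tendsto_nat_ceil_mul_div_atTop (hq.1 x)).comp
      (tendsto_natCast_atTop_atTop (R := ℝ))
    have h3 := (tendsto_const_div_atTop_nhds_zero_nat (n x : ℝ)).add h2
    rw [zero_add] at h3
    refine h3.congr fun k => ?_
    simp only [addBalls, PNat.mk_coe, v, Function.comp]
    push_cast
    ring
  have h2 : Tendsto (fun k : ℕ => ((n.addBalls (v k)).total : ℝ) / k) atTop (𝓝 1) := by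
    rw [← hq.2]
    refine (tendsto_finsetSum _ fun x _ => h1 x).congr fun k => ?_
    rw [total, ← Finset.sum_div]
    push_cast
    rfl
  refine ⟨v, ?_, tendsto_pi_nhds.2 fun x => ?_⟩
  · rw [← tendsto_natCast_atTop_iff (R := ℝ)]
    refine (h2.pos_mul_atTop one_pos tendsto_natCast_atTop_atTop).congr' ?_
    filter_upwards [eventually_gt_atTop 0] with k hk
    have : (k : ℝ) ≠ 0 := by exact_mod_cast hk.ne'
    field_simp
  · have h3 := (h1 x).div h2 one_ne_zero
    rw [div_one] at h3
    refine h3.congr' ?_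
    filter_upwards [eventually_gt_atTop 0] with k hk
    have : (k : ℝ) ≠ 0 := by exact_mod_cast hk.ne'
    simp only [Pi.div_apply, normalized_eq]
    field_simp

variable [Nonempty X]

theorem tendsto_outsideShare (T : Tournament X) {ι : Type*} {l : Filter ι} {m : ι → Urn X}
    {q : X → ℝ} (hm : Tendsto (fun i => (m i).normalized) l (𝓝 q))
    (hq : ∀ a, T.optimalStrategy a = 0 → q a = 0) :
    Tendsto (fun i => (m i).outsideShare T) l (𝓝 0) := by
  classical
  have h : Tendsto (fun i => ∑ a, if T.optimalStrategy a = 0 then (m i).normalized a else 0) l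
      (𝓝 (∑ _a : X, (0 : ℝ))) := by
    refine tendsto_finsetSum _ fun a _ => ?_
    split_ifs with ha
    · rw [← hq a ha]
      exact (tendsto_pi_nhds.1 hm) a
    · exact tendsto_const_nhds
  rw [Finset.sum_const_zero] at h
  refine h.congr fun i => ?_
  unfold outsideShare
  congr!

end Urn

/-- Mixing `p*` with a small weight on the vertex `a` lowers the positive coordinate `b`, so the
relative entropy is positive but arbitrarily small. If `a` is in the support, no new colour appears.
-/
theorem Tournament.exists_relEntropy_lt {X : Type*} [Fintype X] [Nonempty X] (T : Tournament X)
    {a b : X} (hab : a ≠ b) (hb : T.optimalStrategy b ≠ 0) {η : ℝ} (hη : 0 < η) :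
    ∃ q ∈ stdSimplex ℝ X, (∀ x, T.optimalStrategy x ≠ 0 → 0 < q x) ∧
      (T.optimalStrategy a ≠ 0 → ∀ x, T.optimalStrategy x = 0 → q x = 0) ∧
      0 < relEntropy T.optimalStrategy q ∧ relEntropy T.optimalStrategy q < η := by
  classical
  set p := T.optimalStrategy with hp
  have hp0 := T.optimalStrategy_nonneg
  let q : ℝ → X → ℝ := fun t => (1 - t) • p + t • Pi.single a 1
  have hcont : Tendsto (fun t => relEntropy p (q t)) (𝓝[>] 0) (𝓝 0) := by
    suffices h : Tendsto (fun t => relEntropy p (q t)) (𝓝[>] 0) (𝓝 (relEntropy p p)) by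
      rwa [relEntropy_self] at h
    unfold relEntropy
    refine tendsto_finsetSum _ fun x _ => ?_
    by_cases hx : p x = 0
    · simp [hx]
    refine (tendsto_const_nhds.sub (Tendsto.log ?_ hx)).const_mul _
    have : Continuous fun t => q t x := by
      simp only [q]
      fun_prop
    have h := this.tendsto 0
    simp only [q, sub_zero, one_smul, zero_smul, add_zero] at h
    exact h.mono_left nhdsWithin_le_nhds
  obtain ⟨t, ht1, ht2, ht3⟩ := ((hcont.eventually_lt_const hη).and
    (Ioo_mem_nhdsGT (show (0 : ℝ) < 1 by norm_num))).exists
  have hpos : ∀ x, p x ≠ 0 → 0 < q t x := by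
    intro x hx
    have h1 : 0 < p x := lt_of_le_of_ne (hp0 x) (Ne.symm hx)
    have h2 : 0 ≤ (Pi.single a 1 : X → ℝ) x := by
      rw [Pi.single_apply]
      split_ifs <;> norm_num
    have h3 : 0 < (1 - t) * p x := mul_pos (by linarith) h1
    have h4 : 0 ≤ t * (Pi.single a 1 : X → ℝ) x := mul_nonneg ht2.le h2
    simp only [q, Pi.add_apply, Pi.smul_apply, smul_eq_mul]
    linarith
  have hq : q t ∈ stdSimplex ℝ X :=
    (convex_stdSimplex ℝ X) T.optimalStrategy_mem (single_mem_stdSimplex ℝ a)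
      (by linarith) ht2.le (by ring)
  refine ⟨q t, hq, hpos, fun ha x hx => ?_, relEntropy_pos T.optimalStrategy_mem hq hpos ?_, ht1⟩
  · have hxa : x ≠ a := fun h => ha (h ▸ hx)
    simp [q, hx, hxa]
  · intro h
    have h1 := congrFun h b
    simp only [q, Pi.add_apply, Pi.smul_apply, smul_eq_mul, Pi.single_eq_of_ne hab.symm] at h1
    have h2 : t * p b = 0 := by linarith
    exact hb ((mul_eq_zero.1 h2).resolve_left ht2.ne')

/-! ### Nonconvergence -/

namespace IsTwoAlternativesReinforcement

variable {X : Type*} [Fintype X] [Nonempty X] {T : Tournament X} {n₀ : Urn X}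
  {Ω : Type*} [MeasurableSpace Ω] {P : Measure Ω} [IsProbabilityMeasure P] {U : ℕ → Ω → Urn X}

/-- Every urn that contains the initial urn is reached with positive probability. -/
theorem exists_cylinder_ne_zero (hU : IsTwoAlternativesReinforcement T n₀ P U) (v : X → ℕ) :
    ∃ (s : ℕ) (h : ℕ → Urn X), h s = n₀.addBalls v ∧ P {ω | ∀ i ≤ s, U i ω = h i} ≠ 0 := by
  refine Urn.addBalls_induction (C := fun n => ∃ (s : ℕ) (h : ℕ → Urn X), h s = n ∧
    P {ω | ∀ i ≤ s, U i ω = h i} ≠ 0) ⟨0, fun _ => n₀, rfl, fun h0 => ?_⟩ ?_ v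
  · have h1 : ∀ᵐ ω ∂P, ¬ ∀ i ≤ 0, U i ω = n₀ := by
      rw [ae_iff]
      simpa using h0
    obtain ⟨ω, h2, h3⟩ := (h1.and hU.initial).exists
    exact h2 fun i hi => by rw [Nat.le_zero.1 hi, h3]
  · rintro m x ⟨s, h, rfl, hP⟩
    refine ⟨s + 1, Function.update h (s + 1) ((h s).addBall x), by simp, ?_⟩
    have e : {ω | ∀ i ≤ s + 1, U i ω = Function.update h (s + 1) ((h s).addBall x) i}
        = {ω | (∀ i ≤ s, U i ω = h i) ∧ U (s + 1) ω = (h s).addBall x} := by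
      ext ω
      constructor
      · intro H
        refine ⟨fun i hi => ?_, by simpa using H (s + 1) le_rfl⟩
        have := H i (by omega)
        rwa [Function.update_of_ne (by omega)] at this
      · rintro ⟨H1, H2⟩ i hi
        rcases Nat.le_succ_iff.1 hi with h3 | h3
        · rw [Function.update_of_ne (by omega)]
          exact H1 i h3
        · subst h3
          rw [Function.update_self]
          exact H2
    rw [e, hU.step]
    refine mul_ne_zero hP ?_
    rw [ENNReal.ofReal_ne_zero_iff]
    exact Urn.twoAlternativesProb_pos T _ x

/-- If the gap of the initial urn is close to `δ` and there are many balls, almost all of which have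
colours in the Bipartisan Set, then the gap stays close to `δ` with positive probability. -/
theorem measure_forall_abs_gap_sub_pos (hU : IsTwoAlternativesReinforcement T n₀ P U)
    {c d δ : ℝ} (hc : 0 < c) (hd : 0 < d) (hδ : 0 < δ)
    (hp : ∀ a, T.optimalStrategy a ≠ 0 → c ≤ T.optimalStrategy a) (hδc : 32 * δ ≤ c ^ 2)
    (hout : ∀ n : Urn X, n.gap T ≤ 2 * δ → ∀ a, T.optimalStrategy a = 0 →
      T.payoffAgainst a n.normalized ≤ -d)
    (hstart : (n₀.gap T - δ) ^ 2 + (2 * δ / d * n₀.outsideShare T + 2 * (1 / n₀.total))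
      < δ ^ 2 / 8) :
    P {ω | ∀ τ, |(U τ ω).gap T - δ| ≤ δ / 2} ≠ 0 := by
  set G : Set (Urn X) := {m | |m.gap T - δ| ≤ δ / 2} with hG
  let f : Urn X → ℝ := fun m =>
    (m.gap T - δ) ^ 2 + (2 * δ / d * m.outsideShare T + 2 * (1 / m.total))
  have hf0 : ∀ m, (m.gap T - δ) ^ 2 ≤ f m := by
    intro m
    have h1 := mul_nonneg (by positivity : 0 ≤ 2 * δ / d) (m.outsideShare_nonneg T)
    have h2 : 0 < 1 / (m.total : ℝ) := one_div_pos.2 m.total_cast_pos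
    simp only [f]
    linarith
  have hκ : ∀ m ∉ G, δ ^ 2 / 4 ≤ f m := by
    intro m hm
    refine le_trans ?_ (hf0 m)
    have h1 : δ / 2 < |m.gap T - δ| := not_le.1 hm
    rw [← sq_abs (m.gap T - δ)]
    nlinarith
  have hstep : ∀ m ∈ G, Urn.step T f m ≤ f m := by
    intro m hm
    have h1 := (abs_le.1 (show |m.gap T - δ| ≤ δ / 2 from hm)).2
    exact m.step_sq_gap_sub_add_le T hc hd hp hm (by linarith) (hout m (by linarith))
  -- Leaving the band forces `f ≥ δ ^ 2 / 4`, whereas `f` starts below `δ ^ 2 / 8`; so the exit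
  -- probability is at most one half at every horizon.
  have hge : ∀ τ, ENNReal.ofReal (1 / 2) ≤ P {ω | ∀ i ≤ τ, U i ω ∈ G} := by
    intro τ
    have h1 := hU.setIntegral_forall_mem_le hstep hκ τ
    have h2 : 0 ≤ ∫ ω in {ω | ∀ i ≤ τ, U i ω ∈ G}, f (U τ ω) ∂P :=
      integral_nonneg fun ω => (sq_nonneg _).trans (hf0 _)
    have h3 : f n₀ < δ ^ 2 / 8 := hstart
    have h4 : 1 - P.real {ω | ∀ i ≤ τ, U i ω ∈ G} ≤ 1 / 2 := by
      have h5 : 0 < δ ^ 2 / 4 := by positivity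
      refine le_of_mul_le_mul_left ?_ h5
      linarith
    rw [← ofReal_measureReal]
    exact ENNReal.ofReal_le_ofReal (by linarith)
  have hanti : Antitone fun τ => {ω | ∀ i ≤ τ, U i ω ∈ G} :=
    fun s t hst ω h i hi => h i (hi.trans hst)
  have hlim := tendsto_measure_iInter_atTop (μ := P)
    (fun τ => (hU.filtration.le τ _ (hU.measurableSet_forall_mem G τ)).nullMeasurableSet) hanti
    ⟨0, measure_ne_top _ _⟩
  have h5 := ge_of_tendsto' hlim hge
  have e : {ω | ∀ τ, |(U τ ω).gap T - δ| ≤ δ / 2} = ⋂ τ, {ω | ∀ i ≤ τ, U i ω ∈ G} := by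
    ext ω
    simp only [Set.mem_iInter]
    exact ⟨fun h τ i _ => h i, fun h τ => h τ τ le_rfl⟩
  rw [e]
  refine (lt_of_lt_of_le ?_ h5).ne'
  norm_num

/-- The almost surely bounded gap keeps every limit in the interior of the simplex, so the limit is
a rest point with full support, that is, `p*`. Then the gap tends to zero, which has probability
zero. -/
theorem ae_not_tendsto_of_full_support (hU : IsTwoAlternativesReinforcement T n₀ P U)
    (hT : ¬ T.HasCondorcetWinner) (hfull : ∀ a, T.optimalStrategy a ≠ 0) :
    ∀ᵐ ω ∂P, ¬ ∃ p : X → ℝ, Tendsto (fun τ => (U τ ω).normalized) atTop (𝓝 p) := by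
  obtain ⟨a, b, hab, -, -⟩ := T.exists_ne_optimalStrategy_ne_zero hT
  obtain ⟨c, hc, -, hp⟩ := T.exists_le_optimalStrategy
  have hnull : ∀ᵐ ω ∂P, ∀ s, ¬ ((∀ τ, 16 * (U (s + τ) ω).gap T ≤ c ^ 2) ∧
      Tendsto (fun τ => (U (s + τ) ω).gap T) atTop (𝓝 0)) := by
    rw [ae_all_iff]
    intro s
    rw [ae_iff]
    simpa only [not_not] using
      hU.measure_gap_tendsto_eq_zero hab hc (fun a => hp a (hfull a)) s
  filter_upwards [hnull, hU.ae_bddAbove_gap, hU.ae_total_eq,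
    ae_all_iff.2 fun a => hU.ae_rest_of_tendsto a] with ω h1 ⟨K, hK⟩ h2 h3
  rintro ⟨q, hq⟩
  have hqa := tendsto_pi_nhds.1 hq
  have hpos : ∀ a, 0 < q a := fun a =>
    (Real.exp_pos _).trans_le (ge_of_tendsto' (hqa a)
      fun τ => (U τ ω).exp_le_normalized T (hK τ) (hfull a))
  have hqs : q ∈ stdSimplex ℝ X :=
    (isClosed_stdSimplex ℝ X).mem_of_tendsto hq (Eventually.of_forall fun τ => (U τ ω).normalized_mem)
  have hqp := T.eq_optimalStrategy_of_rest hqs (fun a => h3 a q hq) fun a => Or.inl (hpos a).ne'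
  have htot : Tendsto (fun τ => (U τ ω).total) atTop atTop := by
    simp only [h2]
    exact tendsto_atTop_mono (fun τ => Nat.le_add_left τ _) tendsto_id
  have hgap := Urn.tendsto_gap T htot hq fun a _ => hpos a
  rw [hqp, relEntropy_self] at hgap
  obtain ⟨s, hs⟩ := eventually_atTop.1 (hgap.eventually_le_const
    (by positivity : 0 < c ^ 2 / 16))
  refine h1 s ⟨fun τ => ?_, hgap.comp (tendsto_atTop_mono (fun τ => Nat.le_add_left τ s) tendsto_id)⟩
  have := hs (s + τ) (Nat.le_add_right _ _)
  linarith

theorem measure_not_tendsto_pos (hU : IsTwoAlternativesReinforcement T n₀ P U)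
    (hT : ¬ T.HasCondorcetWinner) :
    0 < P {ω | ¬ ∃ p : X → ℝ, Tendsto (fun τ => (U τ ω).normalized) atTop (𝓝 p)} := by
  obtain ⟨a, b, hab, ha, hb⟩ := T.exists_ne_optimalStrategy_ne_zero hT
  obtain ⟨c, hc, hc1, hp⟩ := T.exists_le_optimalStrategy
  obtain ⟨d, hd, -, hdle⟩ := T.exists_payoffAgainst_optimalStrategy_le_neg
  have hcard : (0 : ℝ) < Fintype.card X := by exact_mod_cast Fintype.card_pos
  -- If all shares are within `ε` of `p*`, payoffs change by at most `card X * ε = d / 2`, and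
  -- outside colours still lose by `d / 2`.
  set ε := d / (2 * Fintype.card X) with hε
  have hε0 : 0 < ε := by positivity
  -- The bound `c ^ 2 / 32` keeps `16 * gap ≤ c ^ 2` whenever `gap ≤ 2 δ`, and `ε ^ 2 / 8` keeps the
  -- shares within `ε` of `p*` there.
  obtain ⟨q, hq, hqpos, hqout, hδ, hδlt⟩ := T.exists_relEntropy_lt hab hb
    (lt_min (by positivity : 0 < c ^ 2 / 32) (by positivity : 0 < ε ^ 2 / 8))
  set δ := relEntropy T.optimalStrategy q with hδdef
  have hδc : 32 * δ ≤ c ^ 2 := by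
    have := hδlt.trans_le (min_le_left _ _)
    linarith
  have hδε : 4 * (2 * δ) ≤ ε ^ 2 := by
    have := hδlt.trans_le (min_le_right _ _)
    linarith
  have hout : ∀ n : Urn X, n.gap T ≤ 2 * δ → ∀ a, T.optimalStrategy a = 0 →
      T.payoffAgainst a n.normalized ≤ -(d / 2) := by
    intro n hn a ha
    have h1 := T.payoffAgainst_le_add a (n.abs_normalized_sub_le T hε0.le (by linarith))
    have h2 : Fintype.card X * ε = d / 2 := by
      rw [hε]
      field_simp
    have h3 := hdle a ha
    linarith
  obtain ⟨v, hv1, hv2⟩ := n₀.exists_addBalls_tendsto hq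
  have hlim : Tendsto (fun k => ((n₀.addBalls (v k)).gap T - δ) ^ 2
      + (2 * δ / (d / 2) * (n₀.addBalls (v k)).outsideShare T
        + 2 * (1 / ((n₀.addBalls (v k)).total : ℝ)))) atTop (𝓝 0) := by
    have h1 := ((Urn.tendsto_gap T hv1 hv2 hqpos).sub_const δ).pow 2
    have h2 := (Urn.tendsto_outsideShare T hv2 (hqout ha)).const_mul (2 * δ / (d / 2))
    have h3 := (tendsto_one_div_atTop_nhds_zero_nat (𝕜 := ℝ)).comp hv1 |>.const_mul 2
    have h4 := h1.add (h2.add h3)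
    simpa only [Function.comp_def, ← hδdef, sub_self, mul_zero, add_zero, zero_pow two_ne_zero] using h4
  obtain ⟨k, hk⟩ := (hlim.eventually_lt_const (by positivity : 0 < δ ^ 2 / 8)).exists
  obtain ⟨s, h, hs, hP⟩ := hU.exists_cylinder_ne_zero (v k)
  have hcond := hU.cond_cylinder s h
  have hprob : IsProbabilityMeasure (P[|{ω | ∀ i ≤ s, U i ω = h i}]) :=
    cond_isProbabilityMeasure hP
  rw [hs] at hcond
  have hpos := hcond.measure_forall_abs_gap_sub_pos hc (half_pos hd) hδ hp hδc hout hk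
  rw [pos_iff_ne_zero]
  intro h0
  -- Null sets remain null under conditioning, so it suffices that, almost surely for the
  -- conditional measure, confinement of the gap excludes convergence.
  refine hpos (measure_mono_null_ae ?_ ((cond_absolutelyContinuous (s :=
    {ω | ∀ i ≤ s, U i ω = h i})) h0))
  filter_upwards [hcond.ae_total_eq, ae_all_iff.2 fun a => hcond.ae_rest_of_tendsto a]
    with ω h2 h3 h1
  rintro ⟨r, hr'⟩
  have hr : Tendsto (fun τ => (U (s + τ) ω).normalized) atTop (𝓝 r) :=
    hr'.comp (tendsto_atTop_mono (fun τ => Nat.le_add_left τ s) tendsto_id)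
  have hra := tendsto_pi_nhds.1 hr
  have hle : ∀ τ, (U (s + τ) ω).gap T ≤ 2 * δ := fun τ => by
    linarith [(abs_le.1 (h1 τ)).2]
  have hrpos : ∀ a, T.optimalStrategy a ≠ 0 → 0 < r a := fun a ha =>
    (half_pos hc).trans_le (ge_of_tendsto' (hra a) fun τ =>
      (U (s + τ) ω).half_le_normalized T hc (by linarith [hle τ]) (hp a ha))
  have hrs : r ∈ stdSimplex ℝ X :=
    (isClosed_stdSimplex ℝ X).mem_of_tendsto hr
      (Eventually.of_forall fun τ => (U (s + τ) ω).normalized_mem)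
  -- Colours in the support keep a positive share. Outside colours have payoff at most `-d / 2`
  -- along the whole path, hence also against the limit.
  have hrp := T.eq_optimalStrategy_of_rest hrs (fun a => h3 a r hr) fun a => by
    by_cases ha : T.optimalStrategy a = 0
    · refine Or.inr (le_trans (le_of_tendsto' (((T.continuous_payoffAgainst a).tendsto r).comp hr)
        fun τ => hout _ (hle τ) a ha) ?_)
      linarith
    · exact Or.inl (hrpos a ha).ne'
  have htot : Tendsto (fun τ => (U (s + τ) ω).total) atTop atTop := by
    simp only [h2]
    exact tendsto_atTop_mono (fun τ => Nat.le_add_left τ _) tendsto_id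
  have hgap := Urn.tendsto_gap T htot hr hrpos
  rw [hrp, relEntropy_self] at hgap
  have := ge_of_tendsto' (b := δ / 2) hgap fun τ => by linarith [(abs_le.1 (h1 τ)).1]
  linarith

end IsTwoAlternativesReinforcement

theorem mainTheorem3 {X : Type*} [Fintype X] [Nonempty X] (T : Tournament X) (n₀ : Urn X)
    {Ω : Type*} [MeasurableSpace Ω] (P : Measure Ω) [IsProbabilityMeasure P]
    (U : ℕ → Ω → Urn X) (hU : IsTwoAlternativesReinforcement T n₀ P U) :
    (∀ᵐ ω ∂P, ∀ x, T.optimalStrategy x = 0 →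
      Tendsto (fun τ => (U τ ω).normalized x) atTop (𝓝 0)) ∧
    (¬ T.HasCondorcetWinner →
      0 < P {ω | ¬ ∃ p : X → ℝ, Tendsto (fun τ => (U τ ω).normalized) atTop (𝓝 p)}) ∧
    (¬ T.HasCondorcetWinner → T.bipartisanSet = Set.univ →
      ∀ᵐ ω ∂P, ¬ ∃ p : X → ℝ, Tendsto (fun τ => (U τ ω).normalized) atTop (𝓝 p)) := by
  refine ⟨?_, hU.measure_not_tendsto_pos, fun hT hfull =>
    hU.ae_not_tendsto_of_full_support hT fun a => ?_⟩
  · rw [ae_all_iff]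
    intro x
    by_cases hx : T.optimalStrategy x = 0
    · filter_upwards [hU.ae_tendsto_zero hx] with ω hω _
      exact hω
    · exact ae_of_all _ fun ω h => absurd h hx
  · have : a ∈ T.bipartisanSet := hfull ▸ Set.mem_univ a
    exact this
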